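/- Let $M\ne 0$ be a Hopf--von Neumann algebra acting on a Hilbert space $H$ with orthonormal basis $(e_\alpha)_{\alpha\in A}$, that is, a von Neumann algebra $M\subset B(H)$ with a normal unital coassociative $*$-homomorphism $\Delta:M\to M\bar\otimes M$. Its predual $M_*$ is a Banach algebra with the product $(\mu\nu)(x)=(\mu\otimes\nu)(\Delta(x))$, and for $x\in M$, $\mu\in M_*$ the element $x.\mu=(\mu\otimes\mathrm{id})(\Delta(x))\in M$ is determined by $\nu(x.\mu)=(\mu\nu)(x)$ for all $\nu\in M_*$. Let $P=\{\mu\in M_*:\|\mu\|\le 1,\ \mu(1)=1\}$ be the set of normal states, and put $\mu_{kh}(x)=\langle xh,k\rangle$ for $h,k\in H$. A left covariant representation of $M_*$ on a Banach space $V$ is a pair $(\pi,\xi)$ of a contractive linear map $\pi:M_*\to B(V)$ with $\pi(\mu\nu)=\pi(\mu)\pi(\nu)$ and a contractive linear map $\xi:M_*\to V$ with $\xi(\mu\nu)=\pi(\mu)\xi(\nu)$ for all $\mu,\nu\in M_*$. An element $x\in M$ is a coefficient of $(\pi,\xi)$ if there is $\eta\in V^*$ with $\mu(x)=\langle\xi(\mu),\eta\rangle$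 for all $\mu\in M_*$. The map $\pi$ is $\ell_2$-contractive if for every $n$ and $u=(u_{ij})\in M_n(M_*)$ the operator on $\ell_2^n(V)$ with matrix $(\pi(u_{ij}))$ has norm at most the norm of $u$ in $M_n(M_*)$, where $M_*$ carries the operator space structure dual to that of $M$. A generator of $\pi$ is a bounded operator $U$ on $H\otimes_2 V:=\ell_2(A;V)$ with $$\langle U(h\otimes v),\bar k\otimes\eta\rangle=\langle\pi(\mu_{kh})v,\eta\rangle\qquad(h,k\in H,\ v\in V,\ \eta\in V^*),$$ where $h\otimes v=(\langle h,e_\alpha\rangle v)_\alpha$ and $\langle (v_\alpha)_\alpha,\bar k\otimes\eta\rangle=\sum_\alpha\overline{\langle k,e_\alpha\rangle}\,\langle v_\alpha,\eta\rangle$. Let $WAP_{cb,l}(M)$ be the set of all coefficients of left covariant representations of $M_*$ on reflexive Banach spaces with $\pi$ $\ell_2$-contractive, and let $WAP_{iso,l}(M)$ be the set of those elements of $WAP_{cb,l}(M)$ that are coefficients of a left covariant representation on a reflexive Banach space whose $\pi$ has a generator that is isometric and onto. Suppose that the comultiplication of $M$ is right nontrivial: for $x\in M$, $\Delta(x)=1\otimes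 x$ implies $x\in\mathbb C1$. Then for every $x\in WAP_{iso,l}(M)$ there is a constant $c\in\mathbb C$ such that $c1$ belongs to the norm closure $\overline{x.P}$ of the right orbit $x.P=\{x.\mu:\mu\in P\}$. -/

import Mathlib

open scoped TensorProduct InnerProductSpace

universe u v w

set_option linter.unusedSectionVars false

noncomputable section

namespace HopfVN

/-! ### Hilbert space tensor products -/

section Tensor

variable {E : Type u} [NormedAddCommGroup E] [InnerProductSpace ℂ E]
variable {F : Type u} [NormedAddCommGroup F] [InnerProductSpace ℂ F]

/-- The Hilbert space tensor product: completion of the algebraic tensor product. -/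
def HilbertTensor (E : Type u) [NormedAddCommGroup E] [InnerProductSpace ℂ E]
    (F : Type u) [NormedAddCommGroup F] [InnerProductSpace ℂ F] : Type u :=
  UniformSpace.Completion (E ⊗[ℂ] F)

instance : NormedAddCommGroup (HilbertTensor E F) :=
  inferInstanceAs (NormedAddCommGroup (UniformSpace.Completion (E ⊗[ℂ] F)))

instance : InnerProductSpace ℂ (HilbertTensor E F) :=
  inferInstanceAs (InnerProductSpace ℂ (UniformSpace.Completion (E ⊗[ℂ] F)))

instance : CompleteSpace (HilbertTensor E F) :=
  inferInstanceAs (CompleteSpace (UniformSpace.Completion (E ⊗[ℂ] F)))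

variable (E F) in
/-- The isometric inclusion of the algebraic tensor product. -/
def tensorIncl : E ⊗[ℂ] F →ₗᵢ[ℂ] HilbertTensor E F :=
  (UniformSpace.Completion.toComplₗᵢ : E ⊗[ℂ] F →ₗᵢ[ℂ] UniformSpace.Completion (E ⊗[ℂ] F))

theorem denseRange_tensorIncl : DenseRange (tensorIncl E F) :=
  UniformSpace.Completion.denseRange_coe

/-- The map `v ↦ h ⊗ v`. -/
def tensorL (F : Type u) [NormedAddCommGroup F] [InnerProductSpace ℂ F] (h : E) :
    F →L[ℂ] HilbertTensor E F :=
  (tensorIncl E F).toContinuousLinearMap ∘L TensorProduct.mkL ℂ E F h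

/-- The map `h ↦ h ⊗ v`. -/
def tensorR (E : Type u) [NormedAddCommGroup E] [InnerProductSpace ℂ E] (v : F) :
    E →L[ℂ] HilbertTensor E F :=
  (tensorIncl E F).toContinuousLinearMap ∘L (TensorProduct.mkL ℂ E F).flip v

/-- The elementary tensor `h ⊗ v` in the Hilbert space tensor product. -/
def vecTensor (h : E) (v : F) : HilbertTensor E F := tensorIncl E F (h ⊗ₜ[ℂ] v)

theorem tensorL_apply (h : E) (v : F) : tensorL F h v = vecTensor h v := rfl

theorem tensorR_apply (h : E) (v : F) : tensorR E v h = vecTensor h v := rfl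

theorem inner_vecTensor (h h' : E) (v v' : F) :
    ⟪vecTensor h v, vecTensor h' v'⟫_ℂ = ⟪h, h'⟫_ℂ * ⟪v, v'⟫_ℂ := by
  rw [vecTensor, vecTensor, LinearIsometry.inner_map_map, TensorProduct.inner_tmul]

theorem norm_vecTensor (h : E) (v : F) : ‖vecTensor h v‖ = ‖h‖ * ‖v‖ := by
  rw [vecTensor, LinearIsometry.norm_map, TensorProduct.norm_tmul]

theorem vecTensor_ext {G : Type w} [NormedAddCommGroup G] [NormedSpace ℂ G]
    {S T : HilbertTensor E F →L[ℂ] G}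
    (hST : ∀ h v, S (vecTensor h v) = T (vecTensor h v)) : S = T := by
  ext x
  induction x using denseRange_tensorIncl.induction_on with
  | hp => exact isClosed_eq S.continuous T.continuous
  | ih x =>
    induction x using TensorProduct.induction_on with
    | zero => simp only [map_zero]
    | tmul h v => exact hST h v
    | add x y hx hy => simp only [map_add, hx, hy]

/-- The operator `a ⊗ b` on the Hilbert space tensor product. -/
def opTensor (a : E →L[ℂ] E) (b : F →L[ℂ] F) :
    HilbertTensor E F →L[ℂ] HilbertTensor E F :=
  ((tensorIncl E F).toContinuousLinearMap ∘L TensorProduct.mapL a b).extend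
    (tensorIncl E F).toContinuousLinearMap

theorem opTensor_vecTensor (a : E →L[ℂ] E) (b : F →L[ℂ] F) (h : E) (v : F) :
    opTensor a b (vecTensor h v) = vecTensor (a h) (b v) := by
  have h1 := ContinuousLinearMap.extend_eq
    ((tensorIncl E F).toContinuousLinearMap ∘L TensorProduct.mapL a b)
    (e := (tensorIncl E F).toContinuousLinearMap) denseRange_tensorIncl
    (tensorIncl E F).isometry.isUniformInducing (h ⊗ₜ[ℂ] v)
  rw [ContinuousLinearMap.comp_apply, TensorProduct.mapL_tmul] at h1
  exact h1

end Tensor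

/-! ### Von Neumann algebras, their preduals and tensor products -/

section VN

variable {E : Type u} [NormedAddCommGroup E] [InnerProductSpace ℂ E] [CompleteSpace E]
variable {F : Type u} [NormedAddCommGroup F] [InnerProductSpace ℂ F] [CompleteSpace F]

/-- The type of elements of a von Neumann algebra, a normed unital star algebra. -/
abbrev Elem (M : VonNeumannAlgebra E) : Type u := M.toStarSubalgebra

instance (M : VonNeumannAlgebra E) : NormedAddCommGroup (Elem M) := inferInstance

instance (M : VonNeumannAlgebra E) : NormedSpace ℂ (Elem M) := inferInstance

instance (M : VonNeumannAlgebra E) : Semiring (Elem M) := inferInstance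

instance (M : VonNeumannAlgebra E) : Algebra ℂ (Elem M) := inferInstance

instance (M : VonNeumannAlgebra E) : Star (Elem M) := inferInstance

/-- The von Neumann algebra generated by a set of operators
(the double commutant of `S ∪ S*`). -/
def generated (S : Set (E →L[ℂ] E)) : VonNeumannAlgebra E where
  toStarSubalgebra := StarSubalgebra.centralizer ℂ
    (StarSubalgebra.centralizer ℂ S : Set (E →L[ℂ] E))
  centralizer_centralizer' := by
    change Set.centralizer (Set.centralizer
      ((StarSubalgebra.centralizer ℂ
        (StarSubalgebra.centralizer ℂ S : Set (E →L[ℂ] E)) : StarSubalgebra ℂ (E →L[ℂ] E)) :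
          Set (E →L[ℂ] E))) = ((StarSubalgebra.centralizer ℂ
        (StarSubalgebra.centralizer ℂ S : Set (E →L[ℂ] E)) : StarSubalgebra ℂ (E →L[ℂ] E)) :
          Set (E →L[ℂ] E))
    rw [StarSubalgebra.coe_centralizer, Set.centralizer_centralizer_centralizer]

/-- The von Neumann tensor product, generated by the operators `a ⊗ b`. -/
def vnTensor (M : VonNeumannAlgebra E) (Q : VonNeumannAlgebra F) :
    VonNeumannAlgebra (HilbertTensor E F) :=
  generated {T | ∃ a ∈ M, ∃ b ∈ Q, T = opTensor a b}

/-- The vector functional `μ_{kh} : x ↦ ⟨x h, k⟩` (linear in the first argument of the pairing;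
in Mathlib's convention this is `⟪k, x h⟫`). -/
def vecFunctional (M : VonNeumannAlgebra E) (k h : E) : StrongDual ℂ (Elem M) :=
  LinearMap.mkContinuous
    { toFun := fun x => ⟪k, (x : E →L[ℂ] E) h⟫_ℂ
      map_add' := fun x y => by simp
      map_smul' := fun c x => by simp }
    (‖k‖ * ‖h‖) (fun x => by
      calc ‖⟪k, (x : E →L[ℂ] E) h⟫_ℂ‖ ≤ ‖k‖ * ‖(x : E →L[ℂ] E) h‖ := norm_inner_le_norm _ _
        _ ≤ ‖k‖ * (‖(x : E →L[ℂ] E)‖ * ‖h‖) := by gcongr; exact (x : E →L[ℂ] E).le_opNorm h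
        _ = ‖k‖ * ‖h‖ * ‖x‖ := by rw [show ‖x‖ = ‖(x : E →L[ℂ] E)‖ from rfl]; ring)

theorem vecFunctional_apply (M : VonNeumannAlgebra E) (k h : E) (x : Elem M) :
    vecFunctional M k h x = ⟪k, (x : E →L[ℂ] E) h⟫_ℂ := rfl

/-- The predual `M_*`, i.e. the Banach space of normal functionals on `M`, realised as the
norm closed linear span of the vector functionals in the dual of `M`. -/
def predual (M : VonNeumannAlgebra E) : Submodule ℂ (StrongDual ℂ (Elem M)) :=
  (Submodule.span ℂ (Set.range fun p : E × E => vecFunctional M p.1 p.2)).topologicalClosure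

instance (M : VonNeumannAlgebra E) : NormedAddCommGroup (predual M) :=
  Submodule.normedAddCommGroup _

instance (M : VonNeumannAlgebra E) : NormedSpace ℂ (predual M) := Submodule.normedSpace _

theorem vecFunctional_mem (M : VonNeumannAlgebra E) (k h : E) :
    vecFunctional M k h ∈ predual M :=
  Submodule.le_topologicalClosure _ (Submodule.subset_span ⟨(k, h), rfl⟩)

/-- The vector functional `μ_{kh}` as an element of the predual. -/
def vecPredual (M : VonNeumannAlgebra E) (k h : E) : predual M :=
  ⟨vecFunctional M k h, vecFunctional_mem M k h⟩

theorem predual_le (M : VonNeumannAlgebra E) {P : Submodule ℂ (StrongDual ℂ (Elem M))}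
    (hP : IsClosed (P : Set (StrongDual ℂ (Elem M))))
    (hv : ∀ k h, vecFunctional M k h ∈ P) : predual M ≤ P :=
  Submodule.topologicalClosure_minimal _
    (Submodule.span_le.2 (by rintro _ ⟨p, rfl⟩; exact hv _ _)) hP

theorem elementary_mem (M : VonNeumannAlgebra E) (Q : VonNeumannAlgebra F)
    {a : E →L[ℂ] E} {b : F →L[ℂ] F} (ha : a ∈ M) (hb : b ∈ Q) :
    opTensor a b ∈ vnTensor M Q := by
  change opTensor a b ∈ StarSubalgebra.centralizer ℂ
    ((StarSubalgebra.centralizer ℂ {T | ∃ a ∈ M, ∃ b ∈ Q, T = opTensor a b} :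
      StarSubalgebra ℂ (HilbertTensor E F →L[ℂ] HilbertTensor E F)) : Set _)
  rw [StarSubalgebra.mem_centralizer_iff]
  have key : ∀ g ∈ StarSubalgebra.centralizer ℂ
      {T : HilbertTensor E F →L[ℂ] HilbertTensor E F | ∃ a ∈ M, ∃ b ∈ Q, T = opTensor a b}, g * opTensor a b = opTensor a b * g := by
    intro g hg
    rw [StarSubalgebra.mem_centralizer_iff] at hg
    exact ((hg _ ⟨a, ha, b, hb, rfl⟩).1).symm
  intro g hg
  exact ⟨key g hg, key _ (star_mem hg)⟩

/-- The elementary tensor `a ⊗ b` in the von Neumann tensor product. -/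
def elemTensor {M : VonNeumannAlgebra E} {Q : VonNeumannAlgebra F} (a : Elem M) (b : Elem Q) :
    Elem (vnTensor M Q) :=
  ⟨opTensor a b, elementary_mem M Q a.2 b.2⟩

theorem adjoint_opTensor (a : E →L[ℂ] E) (b : F →L[ℂ] F) :
    star (opTensor a b) = opTensor (star a) (star b) := by
  rw [ContinuousLinearMap.star_eq_adjoint (opTensor a b)]
  refine vecTensor_ext fun h v => ?_
  have h2 : (innerSL ℂ (ContinuousLinearMap.adjoint (opTensor a b) (vecTensor h v)) :
      HilbertTensor E F →L[ℂ] ℂ) =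
      innerSL ℂ (opTensor (star a) (star b) (vecTensor h v)) := by
    refine vecTensor_ext fun h' v' => ?_
    rw [innerSL_apply_apply, innerSL_apply_apply, ContinuousLinearMap.adjoint_inner_left,
      opTensor_vecTensor, opTensor_vecTensor, inner_vecTensor, inner_vecTensor,
      ContinuousLinearMap.star_eq_adjoint a, ContinuousLinearMap.star_eq_adjoint b,
      ContinuousLinearMap.adjoint_inner_left, ContinuousLinearMap.adjoint_inner_left]
  refine ext_inner_right ℂ fun y => ?_
  exact congrArg (fun f : HilbertTensor E F →L[ℂ] ℂ => f y) h2

theorem commute_of_mem_vnTensor (M : VonNeumannAlgebra E) (Q : VonNeumannAlgebra F)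
    {T : HilbertTensor E F →L[ℂ] HilbertTensor E F} (hT : T ∈ vnTensor M Q)
    {g : HilbertTensor E F →L[ℂ] HilbertTensor E F}
    (hg : ∀ a ∈ M, ∀ b ∈ Q, opTensor a b * g = g * opTensor a b) : g * T = T * g := by
  change T ∈ StarSubalgebra.centralizer ℂ
    ((StarSubalgebra.centralizer ℂ {T | ∃ a ∈ M, ∃ b ∈ Q, T = opTensor a b} :
      StarSubalgebra ℂ (HilbertTensor E F →L[ℂ] HilbertTensor E F)) : Set _) at hT
  rw [StarSubalgebra.mem_centralizer_iff] at hT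
  refine (hT g ?_).1
  change g ∈ StarSubalgebra.centralizer ℂ _
  rw [StarSubalgebra.mem_centralizer_iff]
  rintro _ ⟨a, ha, b, hb, rfl⟩
  refine ⟨hg a ha b hb, ?_⟩
  rw [adjoint_opTensor]
  exact hg _ (star_mem ha) _ (star_mem hb)

/-! ### Slice maps -/

/-- The operator `(id ⊗ ω_{kh})(T)` on `E`, for `k h : F`. -/
def vecSliceR (k h : F) (T : HilbertTensor E F →L[ℂ] HilbertTensor E F) : E →L[ℂ] E :=
  ContinuousLinearMap.adjoint (tensorR E k) ∘L T ∘L tensorR E h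

/-- The operator `(ω_{kh} ⊗ id)(T)` on `F`, for `k h : E`. -/
def vecSliceL (k h : E) (T : HilbertTensor E F →L[ℂ] HilbertTensor E F) : F →L[ℂ] F :=
  ContinuousLinearMap.adjoint (tensorL F k) ∘L T ∘L tensorL F h

theorem inner_vecSliceR (k h : F) (T : HilbertTensor E F →L[ℂ] HilbertTensor E F) (x y : E) :
    ⟪x, vecSliceR k h T y⟫_ℂ = ⟪vecTensor x k, T (vecTensor y h)⟫_ℂ := by
  simp [vecSliceR, ContinuousLinearMap.adjoint_inner_right, tensorR_apply]

theorem inner_vecSliceL (k h : E) (T : HilbertTensor E F →L[ℂ] HilbertTensor E F) (x y : F) :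
    ⟪x, vecSliceL k h T y⟫_ℂ = ⟪vecTensor k x, T (vecTensor h y)⟫_ℂ := by
  simp [vecSliceL, ContinuousLinearMap.adjoint_inner_right, tensorL_apply]

theorem mem_of_commutant (M : VonNeumannAlgebra E) {x : E →L[ℂ] E}
    (hx : ∀ g ∈ M.commutant, g * x = x * g) : x ∈ M := by
  rw [← M.commutant_commutant, VonNeumannAlgebra.mem_commutant_iff]
  exact hx

theorem vecSliceR_mem {M : VonNeumannAlgebra E} {Q : VonNeumannAlgebra F} (k h : F)
    {T : HilbertTensor E F →L[ℂ] HilbertTensor E F} (hT : T ∈ vnTensor M Q) :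
    vecSliceR k h T ∈ M := by
  refine mem_of_commutant M fun g hg => ?_
  have hc : opTensor g (1 : F →L[ℂ] F) * T = T * opTensor g 1 := by
    refine commute_of_mem_vnTensor M Q hT fun a ha b hb => vecTensor_ext fun x y => ?_
    have := congrArg (fun f : E →L[ℂ] E => f x)
      (VonNeumannAlgebra.mem_commutant_iff.1 hg a ha)
    simp only [mul_apply_eq_comp] at this
    simp [opTensor_vecTensor, this]
  ext y
  refine ext_inner_left ℂ fun x => ?_
  have e1 : T (opTensor g 1 (vecTensor y h)) = opTensor g 1 (T (vecTensor y h)) :=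
    (congrArg (fun f => f (vecTensor y h)) hc).symm
  rw [mul_apply_eq_comp, mul_apply_eq_comp, inner_vecSliceR,
    ← ContinuousLinearMap.adjoint_inner_left, inner_vecSliceR]
  have e2 : opTensor g 1 (vecTensor y h) = vecTensor (g y) h := by
    simp [opTensor_vecTensor]
  rw [← e2, e1, ← ContinuousLinearMap.adjoint_inner_left (opTensor g 1),
    ← ContinuousLinearMap.star_eq_adjoint (opTensor g 1), adjoint_opTensor, opTensor_vecTensor]
  simp [ContinuousLinearMap.star_eq_adjoint]

theorem vecSliceL_mem {M : VonNeumannAlgebra E} {Q : VonNeumannAlgebra F} (k h : E)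
    {T : HilbertTensor E F →L[ℂ] HilbertTensor E F} (hT : T ∈ vnTensor M Q) :
    vecSliceL k h T ∈ Q := by
  refine mem_of_commutant Q fun g hg => ?_
  have hc : opTensor (1 : E →L[ℂ] E) g * T = T * opTensor 1 g := by
    refine commute_of_mem_vnTensor M Q hT fun a ha b hb => vecTensor_ext fun x y => ?_
    have := congrArg (fun f : F →L[ℂ] F => f y)
      (VonNeumannAlgebra.mem_commutant_iff.1 hg b hb)
    simp only [mul_apply_eq_comp] at this
    simp [opTensor_vecTensor, this]
  ext y
  refine ext_inner_left ℂ fun x => ?_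
  have e1 : T (opTensor 1 g (vecTensor h y)) = opTensor 1 g (T (vecTensor h y)) :=
    (congrArg (fun f => f (vecTensor h y)) hc).symm
  rw [mul_apply_eq_comp, mul_apply_eq_comp, inner_vecSliceL,
    ← ContinuousLinearMap.adjoint_inner_left, inner_vecSliceL]
  have e2 : opTensor 1 g (vecTensor h y) = vecTensor h (g y) := by
    simp [opTensor_vecTensor]
  rw [← e2, e1, ← ContinuousLinearMap.adjoint_inner_left (opTensor 1 g),
    ← ContinuousLinearMap.star_eq_adjoint (opTensor 1 g), adjoint_opTensor, opTensor_vecTensor]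
  simp [ContinuousLinearMap.star_eq_adjoint]


theorem norm_vecSliceR_le (k h : F) (T : HilbertTensor E F →L[ℂ] HilbertTensor E F) :
    ‖(vecSliceR k h T : E →L[ℂ] E)‖ ≤ ‖T‖ * ‖k‖ * ‖h‖ := by
  have hb : ∀ v : F, ‖tensorR E v‖ ≤ ‖v‖ := fun v =>
    ContinuousLinearMap.opNorm_le_bound _ (norm_nonneg v) fun x => by
      rw [tensorR_apply, norm_vecTensor, mul_comm]
  calc ‖(vecSliceR k h T : E →L[ℂ] E)‖
      ≤ ‖ContinuousLinearMap.adjoint (tensorR E k)‖ * ‖T ∘L tensorR E h‖ :=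
        ContinuousLinearMap.opNorm_comp_le _ _
    _ ≤ ‖tensorR E k‖ * (‖T‖ * ‖tensorR E h‖) := by
        rw [LinearIsometryEquiv.norm_map]
        gcongr
        exact ContinuousLinearMap.opNorm_comp_le _ _
    _ ≤ ‖k‖ * (‖T‖ * ‖h‖) := by gcongr <;> exact hb _
    _ = ‖T‖ * ‖k‖ * ‖h‖ := by ring

theorem norm_vecSliceL_le (k h : E) (T : HilbertTensor E F →L[ℂ] HilbertTensor E F) :
    ‖(vecSliceL k h T : F →L[ℂ] F)‖ ≤ ‖T‖ * ‖k‖ * ‖h‖ := by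
  have hb : ∀ v : E, ‖tensorL F v‖ ≤ ‖v‖ := fun v =>
    ContinuousLinearMap.opNorm_le_bound _ (norm_nonneg v) fun x => by
      rw [tensorL_apply, norm_vecTensor]
  calc ‖(vecSliceL k h T : F →L[ℂ] F)‖
      ≤ ‖ContinuousLinearMap.adjoint (tensorL F k)‖ * ‖T ∘L tensorL F h‖ :=
        ContinuousLinearMap.opNorm_comp_le _ _
    _ ≤ ‖tensorL F k‖ * (‖T‖ * ‖tensorL F h‖) := by
        rw [LinearIsometryEquiv.norm_map]
        gcongr
        exact ContinuousLinearMap.opNorm_comp_le _ _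
    _ ≤ ‖k‖ * (‖T‖ * ‖h‖) := by gcongr <;> exact hb _
    _ = ‖T‖ * ‖k‖ * ‖h‖ := by ring

variable {M : VonNeumannAlgebra E} {Q : VonNeumannAlgebra F}

/-- `vecSliceR` as a map into `M`. -/
def sliceR (k h : F) (T : Elem (vnTensor M Q)) : Elem M :=
  ⟨vecSliceR k h T.1, vecSliceR_mem k h T.2⟩

/-- `vecSliceL` as a map into `Q`. -/
def sliceL (k h : E) (T : Elem (vnTensor M Q)) : Elem Q :=
  ⟨vecSliceL k h T.1, vecSliceL_mem k h T.2⟩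

theorem elem_ext {M : VonNeumannAlgebra E} {x y : Elem M}
    (hxy : ∀ k h, ⟪k, (x : E →L[ℂ] E) h⟫_ℂ = ⟪k, (y : E →L[ℂ] E) h⟫_ℂ) : x = y :=
  Subtype.ext (ContinuousLinearMap.ext fun h => ext_inner_left ℂ fun k => hxy k h)

theorem inner_sliceR (k h : F) (T : Elem (vnTensor M Q)) (x y : E) :
    ⟪x, (sliceR k h T : E →L[ℂ] E) y⟫_ℂ =
      ⟪vecTensor x k, (T : HilbertTensor E F →L[ℂ] HilbertTensor E F) (vecTensor y h)⟫_ℂ := by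
  change ⟪x, vecSliceR k h T.1 y⟫_ℂ = _
  rw [inner_vecSliceR]

theorem inner_sliceL (k h : E) (T : Elem (vnTensor M Q)) (x y : F) :
    ⟪x, (sliceL k h T : F →L[ℂ] F) y⟫_ℂ =
      ⟪vecTensor k x, (T : HilbertTensor E F →L[ℂ] HilbertTensor E F) (vecTensor h y)⟫_ℂ := by
  change ⟪x, vecSliceL k h T.1 y⟫_ℂ = _
  rw [inner_vecSliceL]

theorem vecTensor_add_right (x : E) (k k' : F) :
    vecTensor x (k + k') = vecTensor x k + vecTensor x k' := map_add (tensorL F x) k k'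

theorem vecTensor_smul_right (x : E) (c : ℂ) (k : F) :
    vecTensor x (c • k) = c • vecTensor x k := map_smul (tensorL F x) c k

/-- The bounded sesquilinear form `(k, h) ↦ μ ((id ⊗ ω_{kh})(T))` on `F`. -/
def sliceForm (μ : StrongDual ℂ (Elem M)) (T : Elem (vnTensor M Q)) : F →L⋆[ℂ] F →L[ℂ] ℂ :=
  LinearMap.mkContinuous₂
    (LinearMap.mk₂'ₛₗ (starRingEnd ℂ) (RingHom.id ℂ) (fun k h => μ (sliceR k h T))
      (fun k k' h => by
        rw [← map_add]; congr 1; refine elem_ext fun x y => ?_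
        simp [inner_sliceR, vecTensor_add_right])
      (fun c k h => by
        rw [← map_smul]; congr 1; refine elem_ext fun x y => ?_
        simp [inner_sliceR, vecTensor_smul_right, mul_comm])
      (fun k h h' => by
        rw [← map_add]; congr 1; refine elem_ext fun x y => ?_
        simp [inner_sliceR, vecTensor_add_right])
      (fun c k h => by
        rw [← map_smul]; congr 1; refine elem_ext fun x y => ?_
        simp [inner_sliceR, vecTensor_smul_right]))
    (‖μ‖ * ‖T‖) (fun k h => by
      refine (μ.le_opNorm _).trans ?_
      rw [mul_assoc, mul_assoc]
      gcongr
      rw [← mul_assoc]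
      exact norm_vecSliceR_le k h _)

/-- The slice `(μ ⊗ id)(T)`, determined by `⟪k, (μ ⊗ id)(T) h⟫ = μ ((id ⊗ ω_{kh})(T))`. -/
def sliceOp (μ : StrongDual ℂ (Elem M)) (T : Elem (vnTensor M Q)) : F →L[ℂ] F :=
  ContinuousLinearMap.adjoint (InnerProductSpace.continuousLinearMapOfBilin (sliceForm μ T))

theorem inner_sliceOp (μ : StrongDual ℂ (Elem M)) (T : Elem (vnTensor M Q)) (k h : F) :
    ⟪k, sliceOp μ T h⟫_ℂ = μ (sliceR k h T) := by
  rw [sliceOp, ContinuousLinearMap.adjoint_inner_right,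
    InnerProductSpace.continuousLinearMapOfBilin_apply]
  rfl

theorem norm_sliceOp_le (μ : StrongDual ℂ (Elem M)) (T : Elem (vnTensor M Q)) :
    ‖sliceOp μ T‖ ≤ ‖μ‖ * ‖T‖ := by
  refine ContinuousLinearMap.opNorm_le_bound _ (by positivity) fun h => ?_
  have h1 : ‖⟪sliceOp μ T h, sliceOp μ T h⟫_ℂ‖ ≤
      ‖μ‖ * (‖T‖ * ‖sliceOp μ T h‖ * ‖h‖) := by
    rw [inner_sliceOp]
    refine (μ.le_opNorm _).trans ?_
    gcongr
    exact norm_vecSliceR_le _ h _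
  rw [inner_self_eq_norm_sq_to_K] at h1
  simp only [norm_pow, RCLike.norm_ofReal, abs_norm] at h1
  rcases (norm_nonneg (sliceOp μ T h)).eq_or_lt with h0 | h0
  · rw [← h0]; positivity
  · nlinarith

/-- `sliceOp` as a linear map in the functional. -/
def sliceOpL (T : Elem (vnTensor M Q)) : StrongDual ℂ (Elem M) →L[ℂ] (F →L[ℂ] F) :=
  LinearMap.mkContinuous
    { toFun := fun μ => sliceOp μ T
      map_add' := fun μ μ' => ContinuousLinearMap.ext fun h => ext_inner_left ℂ fun k => by
        simp [inner_sliceOp, inner_add_right]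
      map_smul' := fun c μ => ContinuousLinearMap.ext fun h => ext_inner_left ℂ fun k => by
        simp [inner_sliceOp, inner_smul_right] }
    ‖T‖ (fun μ => (norm_sliceOp_le μ T).trans_eq (mul_comm _ _))

theorem sliceOp_vecFunctional (k h : E) (T : Elem (vnTensor M Q)) :
    sliceOp (vecFunctional M k h) T = sliceL k h T :=
  ContinuousLinearMap.ext fun y => ext_inner_left ℂ fun x => by
    rw [inner_sliceOp, vecFunctional_apply, inner_sliceR, inner_sliceL]

theorem isClosed_coe (M : VonNeumannAlgebra E) : IsClosed (M : Set (E →L[ℂ] E)) := by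
  rw [← M.centralizer_centralizer]
  exact Set.isClosed_centralizer _

theorem sliceOp_mem (μ : predual M) (T : Elem (vnTensor M Q)) :
    sliceOp (μ : StrongDual ℂ (Elem M)) T ∈ Q := by
  have hP := predual_le M
    (P := (Subalgebra.toSubmodule Q.toStarSubalgebra.toSubalgebra).comap
      (sliceOpL T : StrongDual ℂ (Elem M) →ₗ[ℂ] (F →L[ℂ] F)))
    ((isClosed_coe Q).preimage (sliceOpL T).continuous)
    (fun k h => by
      change sliceOp (vecFunctional M k h) T ∈ Q
      rw [sliceOp_vecFunctional]
      exact (sliceL k h T).2)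
  exact hP μ.2

/-- The slice map `μ ⊗ id : M ⊗̄ Q → Q` of a normal functional `μ`. -/
def slice (μ : predual M) : Elem (vnTensor M Q) →L[ℂ] Elem Q :=
  LinearMap.mkContinuous
    { toFun := fun T => ⟨sliceOp (μ : StrongDual ℂ (Elem M)) T, sliceOp_mem μ T⟩
      map_add' := fun T T' => elem_ext fun k h => by
        change ⟪k, sliceOp (μ : StrongDual ℂ (Elem M)) (T + T') h⟫_ℂ =
          ⟪k, sliceOp (μ : StrongDual ℂ (Elem M)) T h +
            sliceOp (μ : StrongDual ℂ (Elem M)) T' h⟫_ℂ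
        rw [inner_add_right, inner_sliceOp, inner_sliceOp, inner_sliceOp, ← map_add]
        congr 1
        refine elem_ext fun x y => ?_
        simp [inner_sliceR]
      map_smul' := fun c T => elem_ext fun k h => by
        change ⟪k, sliceOp (μ : StrongDual ℂ (Elem M)) (c • T) h⟫_ℂ =
          ⟪k, c • sliceOp (μ : StrongDual ℂ (Elem M)) T h⟫_ℂ
        rw [inner_smul_right, inner_sliceOp, inner_sliceOp, ← smul_eq_mul, ← map_smul]
        congr 1
        refine elem_ext fun x y => ?_
        simp [inner_sliceR] }
    ‖μ‖ (fun T => norm_sliceOp_le (μ : StrongDual ℂ (Elem M)) T)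

theorem inner_slice (μ : predual M) (T : Elem (vnTensor M Q)) (k h : F) :
    ⟪k, (slice μ T : F →L[ℂ] F) h⟫_ℂ = (μ : StrongDual ℂ (Elem M)) (sliceR k h T) :=
  inner_sliceOp _ T k h

theorem norm_slice_le (μ : predual M) (T : Elem (vnTensor M Q)) :
    ‖slice μ T‖ ≤ ‖μ‖ * ‖T‖ := norm_sliceOp_le _ T

theorem slice_elemTensor (μ : predual M) (a : Elem M) (b : Elem Q) :
    slice μ (elemTensor a b) = (μ : StrongDual ℂ (Elem M)) a • b := by
  refine elem_ext fun k h => ?_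
  have : sliceR k h (elemTensor a b) = ⟪k, (b : F →L[ℂ] F) h⟫_ℂ • a := by
    refine elem_ext fun x y => ?_
    rw [inner_sliceR]
    change ⟪vecTensor x k, opTensor (a : E →L[ℂ] E) (b : F →L[ℂ] F) (vecTensor y h)⟫_ℂ = _
    rw [opTensor_vecTensor, inner_vecTensor]
    simp [mul_comm]
  rw [inner_slice, this]
  simp [mul_comm]

theorem precomp_mem {P : VonNeumannAlgebra F} {R : VonNeumannAlgebra E}
    (f : Elem R →L[ℂ] Elem P) (hf : ∀ k h, vecFunctional P k h ∘L f ∈ predual R)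
    (ν : predual P) : (ν : StrongDual ℂ (Elem P)) ∘L f ∈ predual R := by
  have hP := predual_le P
    (P := (predual R).comap
      ((ContinuousLinearMap.compL ℂ (Elem R) (Elem P) ℂ).flip f :
        StrongDual ℂ (Elem P) →ₗ[ℂ] StrongDual ℂ (Elem R)))
    (IsClosed.preimage ((ContinuousLinearMap.compL ℂ (Elem R) (Elem P) ℂ).flip f).continuous
      (Submodule.isClosed_topologicalClosure _)) hf
  exact hP ν.2

/-- `sliceR` as a bounded linear map. -/
def sliceRL (k h : F) : Elem (vnTensor M Q) →L[ℂ] Elem M :=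
  LinearMap.mkContinuous
    { toFun := fun T => sliceR k h T
      map_add' := fun T T' => elem_ext fun x y => by simp [inner_sliceR]
      map_smul' := fun c T => elem_ext fun x y => by simp [inner_sliceR] }
    (‖k‖ * ‖h‖) (fun T => (norm_vecSliceR_le k h T.1).trans_eq (by
      rw [show ‖T‖ = ‖T.1‖ from rfl]; ring))

theorem tensor_mem (μ : predual M) (ν : predual Q) :
    (ν : StrongDual ℂ (Elem Q)) ∘L slice μ ∈ predual (vnTensor M Q) := by
  refine precomp_mem (slice μ) (fun k h => ?_) ν
  have h1 : vecFunctional Q k h ∘L (slice μ : Elem (vnTensor M Q) →L[ℂ] Elem Q) =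
      (μ : StrongDual ℂ (Elem M)) ∘L sliceRL k h := by
    ext T
    exact inner_slice μ T k h
  rw [h1]
  refine precomp_mem (sliceRL k h) (fun x y => ?_) μ
  have h2 : vecFunctional M x y ∘L (sliceRL k h : Elem (vnTensor M Q) →L[ℂ] Elem M) =
      vecFunctional (vnTensor M Q) (vecTensor x k) (vecTensor y h) := by
    ext T
    exact inner_sliceR k h T x y
  rw [h2]
  exact vecFunctional_mem _ _ _

/-- The product functional `μ ⊗ ν` on `M ⊗̄ Q`, as a normal functional. -/
def tensorPredual (μ : predual M) (ν : predual Q) : predual (vnTensor M Q) :=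
  ⟨(ν : StrongDual ℂ (Elem Q)) ∘L slice μ, tensor_mem μ ν⟩

theorem tensorPredual_apply (μ : predual M) (ν : predual Q) (T : Elem (vnTensor M Q)) :
    (tensorPredual μ ν).1 T = ν.1 (slice μ T) := rfl

theorem tensorPredual_elemTensor (μ : predual M) (ν : predual Q) (a : Elem M) (b : Elem Q) :
    (tensorPredual μ ν).1 (elemTensor a b) = μ.1 a * ν.1 b := by
  rw [tensorPredual_apply, slice_elemTensor, map_smul, smul_eq_mul]

theorem tensorPredual_vecPredual (k h : E) (k' h' : F) :
    tensorPredual (vecPredual M k h) (vecPredual Q k' h') =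
      vecPredual (vnTensor M Q) (vecTensor k k') (vecTensor h h') := by
  refine Subtype.ext (ContinuousLinearMap.ext fun T => ?_)
  exact (inner_slice (vecPredual M k h) T k' h').trans (inner_sliceR k' h' T k h)

/-- Unital star homomorphisms between von Neumann algebras. -/
abbrev VNHom (M : VonNeumannAlgebra E) (Q : VonNeumannAlgebra F) : Type u :=
  Elem M →⋆ₐ[ℂ] Elem Q

/-- A star homomorphism of von Neumann algebras is normal if it pulls normal functionals back
to normal functionals (equivalently, if it is ultraweakly continuous). -/
def IsNormal (f : VNHom M Q) : Prop :=
  ∀ φ : predual Q, ∃ ψ : predual M, ∀ x, ψ.1 x = φ.1 (f x)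

end VN

/-! ### Hopf-von Neumann algebras -/

section Hopf

variable {H : Type u} [NormedAddCommGroup H] [InnerProductSpace ℂ H] [CompleteSpace H]

/-- Coassociativity `(Δ ⊗ id) Δ = (id ⊗ Δ) Δ`. Here `Φ = Δ ⊗ id` and `Ψ = id ⊗ Δ` are the
normal star homomorphisms with the prescribed values on elementary tensors, and operators on
`(H ⊗ H) ⊗ H` and on `H ⊗ (H ⊗ H)` are identified by comparing their matrix coefficients on
elementary tensors. -/
def IsCoassociative {M : VonNeumannAlgebra H} (Δ : VNHom M (vnTensor M M)) : Prop :=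
  ∃ (Φ : VNHom (vnTensor M M) (vnTensor (vnTensor M M) M))
    (Ψ : VNHom (vnTensor M M) (vnTensor M (vnTensor M M))),
    IsNormal Φ ∧ IsNormal Ψ ∧
    (∀ a b : Elem M, Φ (elemTensor a b) = elemTensor (Δ a) b) ∧
    (∀ a b : Elem M, Ψ (elemTensor a b) = elemTensor a (Δ b)) ∧
    ∀ (x : Elem M) (k₁ k₂ k₃ h₁ h₂ h₃ : H),
      ⟪vecTensor (vecTensor k₁ k₂) k₃, (Φ (Δ x)).1 (vecTensor (vecTensor h₁ h₂) h₃)⟫_ℂ =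
      ⟪vecTensor k₁ (vecTensor k₂ k₃), (Ψ (Δ x)).1 (vecTensor h₁ (vecTensor h₂ h₃))⟫_ℂ

/-- A Hopf-von Neumann algebra acting on the Hilbert space `H`: a von Neumann algebra with a
normal unital coassociative star homomorphism `Δ : M → M ⊗̄ M`. -/
structure HopfVonNeumannAlgebra (H : Type u) [NormedAddCommGroup H] [InnerProductSpace ℂ H]
    [CompleteSpace H] where
  /-- The underlying von Neumann algebra. -/
  alg : VonNeumannAlgebra H
  /-- The comultiplication. -/
  comul : VNHom alg (vnTensor alg alg)
  normal : IsNormal comul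
  coassoc : IsCoassociative comul

namespace HopfVonNeumannAlgebra

variable (M : HopfVonNeumannAlgebra H)

/-- The elements of `M`. -/
abbrev El : Type u := Elem M.alg

/-- The predual `M_*`. -/
abbrev Pre : Type u := predual M.alg

variable {M}

/-- The product of the predual: `(μ * ν)(x) = (μ ⊗ ν)(Δ x)`. -/
def conv (μ ν : M.Pre) : M.Pre := Classical.choose (M.normal (tensorPredual μ ν))

theorem conv_apply (μ ν : M.Pre) (x : M.El) :
    (conv μ ν).1 x = (tensorPredual μ ν).1 (M.comul x) :=
  Classical.choose_spec (M.normal (tensorPredual μ ν)) x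

/-- The right module action `x.μ = (μ ⊗ id)(Δ x)` of the predual on `M`; it satisfies
`ν (x.μ) = (μ * ν)(x)` for every normal functional `ν`. -/
def rightAct (x : M.El) (μ : M.Pre) : M.El := slice μ (M.comul x)

theorem apply_rightAct (x : M.El) (μ ν : M.Pre) : ν.1 (rightAct x μ) = (conv μ ν).1 x := by
  rw [conv_apply, tensorPredual_apply, rightAct]

variable (M)

/-- The set `P` of normal states. -/
def normalStates : Set M.Pre := {μ | ‖μ‖ ≤ 1 ∧ μ.1 1 = 1}

/-- The comultiplication is right nontrivial: `Δ x = 1 ⊗ x` only for scalar `x`. -/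
def RightNontrivial : Prop :=
  ∀ x : M.El, M.comul x = elemTensor 1 x → ∃ c : ℂ, x = c • 1

/-! ### Representations of the predual -/

section Rep

variable {ι : Type w} (b : HilbertBasis ι ℂ H)
variable {V : Type v} [NormedAddCommGroup V] [NormedSpace ℂ V]

/-- The space `ℓ₂(V)` over the index set of a basis of `H`, playing the role of `H ⊗₂ V`. -/
abbrev ell2 (ι : Type w) (V : Type v) [NormedAddCommGroup V] : Type (max w v) :=
  lp (fun _ : ι => V) 2

theorem memlp_smul (h : H) (v : V) : Memℓp (fun i => b.repr h i • v) 2 := by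
  have := (lp.memℓp (b.repr h)).summable (by norm_num : 0 < (2 : ENNReal).toReal)
  refine memℓp_gen ((this.mul_right (‖v‖ ^ (2 : ENNReal).toReal)).congr fun i => ?_)
  rw [norm_smul, Real.mul_rpow (norm_nonneg _) (norm_nonneg _)]

/-- The elementary tensor `h ⊗ v = ∑ e_α ⊗ h_α v` in `H ⊗₂ V`. -/
def ellTensor (h : H) (v : V) : ell2 ι V := ⟨fun i => b.repr h i • v, memlp_smul b h v⟩

/-- `U` is a generator of `π`: `⟨U (h ⊗ v), k̄ ⊗ η⟩ = ⟨π(μ_{kh}) v, η⟩` for all `h, k, v, η`.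
The pairing of `∑ e_α ⊗ v_α` with `k̄ ⊗ η` is the (absolutely convergent) sum of
`conj (k_α) η(v_α)`. -/
def IsGenerator (π : M.Pre →L[ℂ] (V →L[ℂ] V)) (U : ell2 ι V →L[ℂ] ell2 ι V) : Prop :=
  ∀ (h k : H) (v : V) (η : StrongDual ℂ V),
    HasSum (fun i => starRingEnd ℂ (b.repr k i) * η (U (ellTensor b h v) i))
      (η (π (vecPredual M.alg k h) v))

/-- The operator on `ℓ₂ⁿ(V)` given by an `n × n` matrix of operators on `V`. -/
def blockOp {n : ℕ} (u : Matrix (Fin n) (Fin n) (V →L[ℂ] V)) :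
    PiLp 2 (fun _ : Fin n => V) →L[ℂ] PiLp 2 (fun _ : Fin n => V) :=
  (PiLp.continuousLinearEquiv 2 ℂ (fun _ : Fin n => V)).symm.toContinuousLinearMap ∘L
    ContinuousLinearMap.pi fun j => ∑ k, u j k ∘L PiLp.proj 2 (fun _ : Fin n => V) k

/-- The dual operator space norm on `M_n(M_*)`: the supremum of the norms of the scalar
`n² × n²` matrices `(u_{ij}(x_{kl}))` over `x` in the unit ball of `M_n(M)`, where `M_n(M)` is
normed as an algebra of operators on `Hⁿ`. -/
def preMatrixNorm {n : ℕ} (u : Matrix (Fin n) (Fin n) M.Pre) : ℝ :=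
  sSup {r | ∃ x : Matrix (Fin n) (Fin n) M.El,
    ‖blockOp (x.map fun y => (y : H →L[ℂ] H))‖ ≤ 1 ∧
    r = ‖Matrix.toEuclideanCLM (𝕜 := ℂ) (Matrix.of fun p q : Fin n × Fin n =>
      (u p.1 q.1).1 (x p.2 q.2))‖}

/-- `π` is `ℓ₂`-contractive. -/
def IsEll2Contractive (π : M.Pre →L[ℂ] (V →L[ℂ] V)) : Prop :=
  ∀ (n : ℕ) (u : Matrix (Fin n) (Fin n) M.Pre), ‖blockOp (u.map π)‖ ≤ M.preMatrixNorm u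

/-- `(π, ξ)` is a left covariant representation of `M_*` on `V`. -/
structure IsLeftCovariant (π : M.Pre →L[ℂ] (V →L[ℂ] V)) (ξ : M.Pre →L[ℂ] V) : Prop where
  norm_rep_le : ‖π‖ ≤ 1
  map_conv : ∀ μ ν, π (conv μ ν) = π μ ∘L π ν
  norm_cocycle_le : ‖ξ‖ ≤ 1
  covariant : ∀ μ ν, ξ (conv μ ν) = π μ (ξ ν)

/-- `x` is the coefficient `μ ↦ ⟨ξ(μ), η⟩` of `ξ`. -/
def IsCoefficient (x : M.El) (ξ : M.Pre →L[ℂ] V) (η : StrongDual ℂ V) : Prop :=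
  ∀ μ : M.Pre, μ.1 x = η (ξ μ)

end Rep

/-- Reflexivity: the canonical map into the bidual is onto. -/
def IsReflexive (V : Type v) [NormedAddCommGroup V] [NormedSpace ℂ V] : Prop :=
  Function.Surjective (NormedSpace.inclusionInDoubleDual ℂ V)

/-- `WAP_{cb,l}(M)`: coefficients of left covariant representations with `π` `ℓ₂`-contractive
on reflexive Banach spaces (in the universe `v`). -/
def WAPcbL : Set M.El :=
  {x | ∃ (V : Type v) (_ : NormedAddCommGroup V) (_ : NormedSpace ℂ V) (_ : CompleteSpace V)
    (π : M.Pre →L[ℂ] (V →L[ℂ] V)) (ξ : M.Pre →L[ℂ] V) (η : StrongDual ℂ V),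
    IsReflexive V ∧ M.IsLeftCovariant π ξ ∧ M.IsEll2Contractive π ∧ M.IsCoefficient x ξ η}

/-- `WAP_{iso,l}(M)`: the elements of `WAP_{cb,l}(M)` which are coefficients of left covariant
representations on reflexive Banach spaces having a generator that is isometric and onto. -/
def WAPisoL {ι : Type w} (b : HilbertBasis ι ℂ H) : Set M.El :=
  {x | x ∈ WAPcbL.{u, v} M ∧
    ∃ (V : Type v) (_ : NormedAddCommGroup V) (_ : NormedSpace ℂ V) (_ : CompleteSpace V)
    (π : M.Pre →L[ℂ] (V →L[ℂ] V)) (ξ : M.Pre →L[ℂ] V) (η : StrongDual ℂ V)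
    (U : ell2 ι V →L[ℂ] ell2 ι V),
    IsReflexive V ∧ M.IsLeftCovariant π ξ ∧ M.IsCoefficient x ξ η ∧
    M.IsGenerator b π U ∧ Isometry U ∧ Function.Surjective U}

/-- The right orbit `x.P`. -/
def rightOrbit (x : M.El) : Set M.El := {y | ∃ μ ∈ M.normalStates, y = rightAct x μ}

end HopfVonNeumannAlgebra

end Hopf

end HopfVN

end

/-! Write `x` as the coefficient of `(π, ξ)` at `η`, with generator `U` isometric and onto. It
suffices to find, in the norm closure of `{η ∘ π(μ) : μ ∈ P}`, a functional `η₀` with `η₀ ∘ π(μ) =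
μ(1) η₀` for all `μ`. Since `ν(x.μ) = (η ∘ π(μ))(ξ ν)` and `ξ` is contractive, norm convergence of
functionals passes to the orbit of `x`. The limit `y` has `(ρν)(y) = ρ(1) ν(y)`, so `Δ y = 1 ⊗ y`,
and right nontriviality makes `y` scalar.

To find `η₀`, note that by reflexivity the norm closure of this convex set is weak-star compact, and
that it is invariant under the transposes of `π(μ)`, `μ ∈ P`. A minimal invariant weak-star compact
convex subset `L` lies on a sphere, because these transposes are contractions
(`exists_minimal_invariant`). If the radius is positive, Hahn–Banach and reflexivity give one vector
`v₀` at which every member of `L` attains its norm (`exists_forall_apply_eq_norm_mul`).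

Now read `U` as a matrix over the basis with entries `π(μ_{βα})`. The diagonal entries `A_β` come
from vector states, so for `θ ∈ L` also `θ ∘ A_β ∈ L` attains its norm at `v₀`. As `U` is a
contraction of an `ℓ₂` sum, `θ` must annihilate the rest of row `β`: a small perturbation in another
coordinate changes the norm only to second order, but would change the value to first order
(`apply_single_eq_zero_of_norming`). Hence only `A_β` matters on `L`, and since `U` is isometric and
onto, the transpose of `A_β` preserves distances in `L` (`norm_comp_diagonal`). The Ryll-Nardzewski
theorem gives a common fixed point `η₀` of these transposes. It is fixed by diagonal entries and
killed by off-diagonal ones, which is the required invariance on the functionals `μ_{βα}`, whose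
span is dense in the predual. -/

noncomputable section

open Set Topology

/-! ### Minimal closed sets in compact sets -/

/-- Among the nonempty closed subsets of a compact set having a property stable under
intersections there is a minimal one. -/
theorem exists_minimal_closed_subset {E : Type*} [TopologicalSpace E] [T2Space E]
    (Q : Set E → Prop)
    (hQ : ∀ F : Set (Set E), F.Nonempty → (∀ s ∈ F, Q s) → Q (⋂₀ F))
    {K : Set E} (hK : IsCompact K) (hne : K.Nonempty) (hQK : Q K) :
    ∃ L ⊆ K, L.Nonempty ∧ IsClosed L ∧ Q L ∧
      ∀ L' ⊆ L, L'.Nonempty → IsClosed L' → Q L' → L' = L := by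
  obtain ⟨L, hL⟩ := zorn_superset {t : Set E | t ⊆ K ∧ t.Nonempty ∧ IsClosed t ∧ Q t} (by
    intro F hFS hF
    -- The empty chain has empty intersection data, so `K` itself serves as its bound.
    obtain rfl | hFne := F.eq_empty_or_nonempty
    · exact ⟨K, ⟨Subset.rfl, hne, hK.isClosed, hQK⟩, fun _ => False.elim⟩
    obtain ⟨t₀, ht₀⟩ := hFne
    refine ⟨⋂₀ F, ⟨(sInter_subset_of_mem ht₀).trans (hFS ht₀).1, ?_,
      isClosed_sInter fun t ht => (hFS ht).2.2.1, hQ F ⟨t₀, ht₀⟩ fun t ht => (hFS ht).2.2.2⟩,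
      fun t ht => sInter_subset_of_mem ht⟩
    have : Nonempty F := ⟨⟨t₀, ht₀⟩⟩
    rw [sInter_eq_iInter]
    refine IsCompact.nonempty_iInter_of_directed_nonempty_isCompact_isClosed _ (fun t u => ?_)
      (fun t => (hFS t.2).2.1)
      (fun t => hK.of_isClosed_subset (hFS t.2).2.2.1 (hFS t.2).1) fun t => (hFS t.2).2.2.1
    obtain htu | hut := hF.total t.2 u.2
    exacts [⟨t, Subset.rfl, htu⟩, ⟨u, hut, Subset.rfl⟩])
  obtain ⟨hLK, hLne, hLc, hLQ⟩ := hL.prop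
  exact ⟨L, hLK, hLne, hLc, hLQ, fun L' hL' h1 h2 h3 =>
    hL.eq_of_subset ⟨hL'.trans hLK, h1, h2, h3⟩ hL'⟩

/-! ### Extreme points and Milman's converse -/

section LocallyConvex

variable {E : Type*} [AddCommGroup E] [Module ℝ E] [TopologicalSpace E] [T2Space E]
  [IsTopologicalAddGroup E] [ContinuousSMul ℝ E]

/-- An extreme point in the closed convex hull of a union lies in one of the closed hulls. -/
theorem mem_closure_convexHull_union {K A B : Set E} (hK : IsCompact K) (hKc : Convex ℝ K)
    (hA : A ⊆ K) (hB : B ⊆ K) {e : E} (he : e ∈ K.extremePoints ℝ)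
    (heAB : e ∈ closure (convexHull ℝ (A ∪ B))) :
    e ∈ closure (convexHull ℝ A) ∨ e ∈ closure (convexHull ℝ B) := by
  have hsub : ∀ {A : Set E}, A ⊆ K → closure (convexHull ℝ A) ⊆ K := fun hA =>
    closure_minimal (convexHull_min hA hKc) hK.isClosed
  have hcomp : ∀ {A : Set E}, A ⊆ K → IsCompact (closure (convexHull ℝ A)) := fun hA =>
    hK.of_isClosed_subset isClosed_closure (hsub hA)
  rcases A.eq_empty_or_nonempty with rfl | hAne
  · right; simpa using heAB
  rcases B.eq_empty_or_nonempty with rfl | hBne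
  · left; simpa using heAB
  -- The join of two compact convex sets is a continuous image of a compact set, hence already
  -- closed; so `e` is itself a convex combination of points of the two closed hulls, and
  -- extremality finishes.
  have hJ : IsCompact ((fun p : ℝ × E × E => (1 - p.1) • p.2.1 + p.1 • p.2.2) ''
      (Icc (0 : ℝ) 1 ×ˢ (closure (convexHull ℝ A) ×ˢ closure (convexHull ℝ B)))) :=
    (isCompact_Icc.prod ((hcomp hA).prod (hcomp hB))).image (by fun_prop)
  have hmem := closure_minimal (fun z hz => by
    rw [convexHull_union hAne hBne, mem_convexJoin] at hz
    obtain ⟨a, ha, b, hb, hz⟩ := hz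
    rw [segment_eq_image] at hz
    obtain ⟨θ, hθ, rfl⟩ := hz
    exact ⟨(θ, a, b), ⟨hθ, subset_closure ha, subset_closure hb⟩, rfl⟩) hJ.isClosed heAB
  obtain ⟨⟨t, a, b⟩, ⟨ht, ha, hb⟩, rfl⟩ := hmem
  dsimp only at ht ha hb he ⊢
  rcases ht.1.eq_or_lt with h0 | h0
  · left; simpa [← h0] using ha
  rcases ht.2.eq_or_lt with h1 | h1
  · right; simpa [h1] using hb
  have := (mem_extremePoints.1 he).2 a (hsub hA ha) b (hsub hB hb)
    ⟨1 - t, t, by linarith, h0, by ring, rfl⟩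
  left; rw [← this.1]; exact ha

/-- An extreme point in the closed convex hull of a finite union lies in one of the closed
hulls. -/
theorem exists_mem_closure_convexHull_of_biUnion {α : Type*} {K : Set E} (hK : IsCompact K)
    (hKc : Convex ℝ K) {e : E} (he : e ∈ K.extremePoints ℝ) (B : α → Set E)
    (hB : ∀ i, B i ⊆ K) (t : Finset α)
    (heB : e ∈ closure (convexHull ℝ (⋃ i ∈ t, B i))) :
    ∃ i ∈ t, e ∈ closure (convexHull ℝ (B i)) := by
  classical
  induction t using Finset.induction_on with
  | empty => simp at heB
  | insert a t _ ih =>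
    rw [Finset.set_biUnion_insert] at heB
    rcases mem_closure_convexHull_union hK hKc (hB a) (iUnion₂_subset fun i _ => hB i) he heB
      with h | h
    · exact ⟨a, Finset.mem_insert_self _ _, h⟩
    · obtain ⟨i, hi, h⟩ := ih h
      exact ⟨i, Finset.mem_insert_of_mem hi, h⟩

variable [LocallyConvexSpace ℝ E]

/-- Milman's converse of the Krein–Milman theorem. -/
theorem mem_closure_of_mem_extremePoints {K A : Set E} (hK : IsCompact K) (hKc : Convex ℝ K)
    (hA : A ⊆ K) {e : E} (he : e ∈ K.extremePoints ℝ) (heA : e ∈ closure (convexHull ℝ A)) :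
    e ∈ closure A := by
  rw [mem_closure_iff_nhds]
  intro N hN
  have hN0 : (fun y => e - y) ⁻¹' N ∈ 𝓝 (0 : E) := by
    refine (Continuous.tendsto (by fun_prop : Continuous fun y : E => e - y) 0) ?_
    simpa using hN
  -- Two nested neighbourhoods of `0` are needed: a convex `U`, so that the hull of a `U`-small
  -- piece of `A` stays small, inside a closed `C`, so that the closed hull does too.
  obtain ⟨C, ⟨hC, hCcl⟩, hCN⟩ := (closed_nhds_basis (0 : E)).mem_iff.1 hN0
  obtain ⟨U, hU, hUc, hUC⟩ :=
    (locallyConvexSpace_iff_exists_convex_subset_zero ℝ E).1 inferInstance _ hC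
  have hAcl : IsCompact (closure A) :=
    hK.of_isClosed_subset isClosed_closure (closure_minimal hA hK.isClosed)
  obtain ⟨t, ht⟩ := hAcl.elim_finite_subcover
    (fun a : A => (fun y => y - (a : E)) ⁻¹' interior U)
    (fun a => isOpen_interior.preimage (by fun_prop)) (by
      intro y hy
      have h1 : (fun a => y - a) ⁻¹' interior U ∈ 𝓝 y := by
        refine (Continuous.tendsto (by fun_prop : Continuous fun a : E => y - a) y) ?_
        simpa using interior_mem_nhds.2 hU
      obtain ⟨a, ha, haA⟩ := mem_closure_iff_nhds.1 hy _ h1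
      exact mem_iUnion.2 ⟨⟨a, haA⟩, ha⟩)
  obtain ⟨a, -, hea⟩ := exists_mem_closure_convexHull_of_biUnion hK hKc he
    (fun a : A => A ∩ (fun y => y - (a : E)) ⁻¹' interior U)
    (fun a => inter_subset_left.trans hA) t (by
      refine closure_mono (convexHull_mono fun y hy => ?_) heA
      obtain ⟨a, ha, hya⟩ := mem_iUnion₂.1 (ht (subset_closure hy))
      exact mem_iUnion₂.2 ⟨a, ha, hy, hya⟩)
  have hsub : closure (convexHull ℝ (A ∩ (fun y => y - (a : E)) ⁻¹' interior U)) ⊆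
      (fun y => y - (a : E)) ⁻¹' C := by
    refine closure_minimal (((convexHull_mono inter_subset_right).trans
      (convexHull_min (preimage_mono interior_subset) ?_)).trans (preimage_mono hUC))
      (hCcl.preimage (by fun_prop))
    intro x hx y hy p q hp hq hpq
    have := hUc hx hy hp hq hpq
    rwa [mem_preimage, show p • x + q • y - (a : E) = p • (x - (a : E)) + q • (y - (a : E)) by
      rw [smul_sub, smul_sub, sub_add_sub_comm, ← add_smul, hpq, one_smul]]
  have := hCN (hsub hea)
  exact ⟨a, by simpa using this, a.2⟩

/-! ### The Ryll-Nardzewski fixed point theorem -/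

/-- **Ryll-Nardzewski fixed point theorem** for a monoid of continuous linear maps that preserves
a compact convex set `K` and is isometric there with respect to a distance function `d` whose
closed balls are closed and for which `K` is separable. -/
theorem exists_fixedPoint_of_isometric {K : Set E} (hK : IsCompact K) (hKc : Convex ℝ K)
    (hKne : K.Nonempty) (S : Submonoid (E →L[ℝ] E)) (hSK : ∀ s ∈ S, MapsTo s K K)
    (d : E → E → ℝ) (hd0 : ∀ x y, d x y ≤ 0 → x = y) (hds : ∀ x y, d x y = d y x)
    (hdt : ∀ x y z, d x z ≤ d x y + d y z)
    (hdS : ∀ s ∈ S, ∀ x ∈ K, ∀ y ∈ K, d (s x) (s y) = d x y)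
    (hdc : ∀ x r, IsClosed {y | d x y ≤ r})
    (hsep : ∀ ε > 0, ∃ D : Set E, D.Countable ∧ ∀ x ∈ K, ∃ y ∈ D, d y x ≤ ε) :
    ∃ x ∈ K, ∀ s ∈ S, s x = x := by
  obtain ⟨L, hLK, hLne, hLcl, ⟨hLc, hLS⟩, hLmin⟩ := exists_minimal_closed_subset
    (fun t : Set E => Convex ℝ t ∧ ∀ s ∈ S, MapsTo s t t)
    (fun F _ h => ⟨convex_sInter fun t ht => (h t ht).1, fun s hs x hx t ht =>
      (h t ht).2 s hs (hx t ht)⟩) hK hKne ⟨hKc, hSK⟩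
  have hL := hK.of_isClosed_subset hLcl hLK
  obtain ⟨X, hXL, ⟨x₀, hx₀⟩, hXcl, hXS, hXmin⟩ := exists_minimal_closed_subset
    (fun t : Set E => ∀ s ∈ S, MapsTo s t t)
    (fun F _ h s hs x hx t ht => h t ht s hs (hx t ht)) hL hLne hLS
  have hX := hL.of_isClosed_subset hXcl hXL
  -- orbits
  have horb : ∀ x, ∀ s ∈ S, MapsTo s ((fun s : E →L[ℝ] E => s x) '' S)
      ((fun s : E →L[ℝ] E => s x) '' S) := by
    rintro x s hs _ ⟨t, ht, rfl⟩
    exact ⟨s * t, S.mul_mem hs ht, rfl⟩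
  have horbne : ∀ x, ((fun s : E →L[ℝ] E => s x) '' S).Nonempty := fun x =>
    ⟨_, 1, S.one_mem, rfl⟩
  have hdense : ∀ x ∈ X, closure ((fun s : E →L[ℝ] E => s x) '' S) = X := fun x hx =>
    hXmin _ (closure_minimal (by rintro _ ⟨s, hs, rfl⟩; exact hXS s hs hx) hXcl)
      (horbne x).closure isClosed_closure
      fun s hs => (horb x s hs).closure s.continuous
  have hhull : ∀ x ∈ L, closure (convexHull ℝ ((fun s : E →L[ℝ] E => s x) '' S)) = L :=
    fun x hx => hLmin _ (closure_minimal (convexHull_min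
        (by rintro _ ⟨s, hs, rfl⟩; exact hLS s hs hx) hLc) hLcl)
      ((horbne x).mono (subset_convexHull ℝ _)).closure isClosed_closure
      ⟨(convex_convexHull ℝ _).closure, fun s hs =>
        MapsTo.closure (fun y hy => by
          have h1 : s y ∈ (s : E →ₗ[ℝ] E) '' convexHull ℝ ((fun s : E →L[ℝ] E => s x) '' S) :=
            ⟨y, hy, rfl⟩
          rw [LinearMap.image_convexHull] at h1
          exact convexHull_mono (horb x s hs).image_subset h1) s.continuous⟩
  obtain ⟨e, he⟩ := hL.extremePoints_nonempty hLne
  -- By minimality of `L` the closed hull of each orbit is all of `L`, so Milman's converse puts the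
  -- extreme point `e` in every orbit closure.
  have heorb : ∀ x ∈ L, e ∈ closure ((fun s : E →L[ℝ] E => s x) '' S) := fun x hx =>
    mem_closure_of_mem_extremePoints hL hLc (by rintro _ ⟨s, hs, rfl⟩; exact hLS s hs hx) he
      (by rw [hhull x hx]; exact extremePoints_subset he)
  have heX : e ∈ X := by rw [← hdense x₀ hx₀]; exact heorb x₀ (hXL hx₀)
  -- The minimal set `X` is a single point: two of its points can be moved together into a
  -- relatively open piece of small `d`-diameter, and moving them does not change their distance.
  have key : ∀ x ∈ X, ∀ y ∈ X, x = y := by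
    intro x hx y hy
    refine hd0 x y (le_of_forall_pos_le_add fun ε hε => ?_)
    rw [zero_add]
    obtain ⟨D, hD, hDK⟩ := hsep (ε / 2) (by positivity)
    -- Baire: some relatively open piece of `X` is small
    obtain ⟨z, W, hW, hWX, hWz⟩ : ∃ z : E, ∃ W : Set E, IsOpen W ∧ (W ∩ X).Nonempty ∧
        ∀ y ∈ W ∩ X, d z y ≤ ε / 2 := by
      have : CompactSpace X := isCompact_iff_compactSpace.1 hX
      have : Nonempty X := ⟨⟨x₀, hx₀⟩⟩
      have : Countable D := hD
      obtain ⟨⟨z, hz⟩, ⟨p, hp⟩⟩ := nonempty_interior_of_iUnion_of_closed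
        (f := fun z : D => {y : X | d z y ≤ ε / 2})
        (fun z => (hdc z (ε / 2)).preimage continuous_subtype_val) (by
          refine eq_univ_of_forall fun y => ?_
          obtain ⟨z, hz, hzy⟩ := hDK y (hLK (hXL y.2))
          exact mem_iUnion.2 ⟨⟨z, hz⟩, hzy⟩)
      obtain ⟨W, hW, hWi⟩ := isOpen_induced_iff.1
        (isOpen_interior (s := {y : X | d z y ≤ ε / 2}))
      refine ⟨z, W, hW, ⟨p, ?_, p.2⟩, fun y hy => ?_⟩
      · have : p ∈ Subtype.val ⁻¹' W := by rw [hWi]; exact hp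
        exact this
      · have : (⟨y, hy.2⟩ : X) ∈ Subtype.val ⁻¹' W := hy.1
        rw [hWi] at this
        exact (interior_subset this : (⟨y, hy.2⟩ : X) ∈ {y : X | d z y ≤ ε / 2})
    obtain ⟨q, hqW, hqX⟩ := hWX
    rw [← hdense e heX] at hqX
    obtain ⟨_, hsW, s, hs, rfl⟩ := mem_closure_iff.1 hqX W hW hqW
    -- some element of the monoid moves both points close to `e`
    have hpair : (e, e) ∈ closure ((fun t : E →L[ℝ] E => (t x, t y)) '' S) := by
      have hsub : closure ((fun t : E →L[ℝ] E => (t x, t y)) '' S) ⊆ X ×ˢ X :=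
        closure_minimal (by
          rintro _ ⟨t, ht, rfl⟩; exact ⟨hXS t ht hx, hXS t ht hy⟩) (hXcl.prod hXcl)
      have hc : IsCompact (closure ((fun t : E →L[ℝ] E => (t x, t y)) '' S)) :=
        (hX.prod hX).of_isClosed_subset isClosed_closure hsub
      have hm := hc.image (by fun_prop :
        Continuous fun p : E × E => (1 / 2 : ℝ) • p.1 + (1 / 2 : ℝ) • p.2)
      -- The orbit of the midpoint accumulates at `e`. By compactness `e` is the midpoint of a limit
      -- `(x', y')` of the pair orbit, and extremality forces `x' = y' = e`.
      have hz : (1 / 2 : ℝ) • x + (1 / 2 : ℝ) • y ∈ L :=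
        hLc (hXL hx) (hXL hy) (by norm_num) (by norm_num) (by norm_num)
      obtain ⟨⟨x', y'⟩, hxy, hxye⟩ := closure_minimal (by
        rintro _ ⟨t, ht, rfl⟩
        exact ⟨(t x, t y), subset_closure ⟨t, ht, rfl⟩, by simp⟩) hm.isClosed (heorb _ hz)
      dsimp only at hxye
      have h2 := (mem_extremePoints.1 he).2 x' (hXL (hsub hxy).1) y' (hXL (hsub hxy).2)
        ⟨1 / 2, 1 / 2, by norm_num, by norm_num, by norm_num, hxye⟩
      rw [h2.1, h2.2] at hxy
      exact hxy
    have hnhds : (s ⁻¹' W) ×ˢ (s ⁻¹' W) ∈ 𝓝 (e, e) :=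
      prod_mem_nhds ((hW.preimage s.continuous).mem_nhds hsW)
        ((hW.preimage s.continuous).mem_nhds hsW)
    obtain ⟨_, ⟨hx1, hy1⟩, t, ht, rfl⟩ := mem_closure_iff_nhds.1 hpair _ hnhds
    dsimp only at hx1 hy1
    have hxd := hWz _ ⟨hx1, hXS s hs (hXS t ht hx)⟩
    have hyd := hWz _ ⟨hy1, hXS s hs (hXS t ht hy)⟩
    have hK' : ∀ {x}, x ∈ X → x ∈ K := fun h => hLK (hXL h)
    rw [← hdS t ht x (hK' hx) y (hK' hy),
      ← hdS s hs _ (hSK t ht (hK' hx)) _ (hSK t ht (hK' hy))]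
    have := hdt (s (t x)) z (s (t y))
    rw [hds _ z] at this
    linarith
  exact ⟨x₀, hLK (hXL hx₀), fun s hs => key _ (hXS s hs hx₀) _ hx₀⟩

end LocallyConvex

/-! ### Fixed points in the dual of a reflexive space -/

section Reflexive

variable {V : Type v} [NormedAddCommGroup V] [NormedSpace ℂ V]

/-- Convexity and the fixed point theorem use real scalars, whereas the dual is complex. -/
instance WeakDual.instLocallyConvexSpaceReal : LocallyConvexSpace ℝ (WeakDual ℂ V) :=
  inferInstanceAs (LocallyConvexSpace ℝ (WeakBilin (topDualPairing ℂ V)))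

instance WeakDual.instIsScalarTowerReal : IsScalarTower ℝ ℂ (WeakDual ℂ V) :=
  inferInstanceAs (IsScalarTower ℝ ℂ (StrongDual ℂ V))

instance WeakDual.instContinuousSMulReal : ContinuousSMul ℝ (WeakDual ℂ V) :=
  IsScalarTower.continuousSMul ℂ

theorem WeakDual.convex_closure {s : Set (WeakDual ℂ V)} (hs : Convex ℝ s) :
    Convex ℝ (closure s) :=
  @Convex.closure ℝ (WeakDual ℂ V) _ _ _ _ _ _ inferInstance _ hs

theorem WeakDual.convex_image_toStrongDual {s : Set (WeakDual ℂ V)} (hs : Convex ℝ s) :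
    Convex ℝ ((WeakDual.toStrongDual : WeakDual ℂ V ≃ₗ[ℂ] StrongDual ℂ V) '' s) := by
  rintro _ ⟨x, hx, rfl⟩ _ ⟨y, hy, rfl⟩ p q hp hq hpq
  exact ⟨_, hs hx hy hp hq hpq, rfl⟩

/-- The transpose of a bounded operator, as a weak-star continuous map. -/
def weakTranspose (A : V →L[ℂ] V) : WeakDual ℂ V →L[ℝ] WeakDual ℂ V where
  toFun η := StrongDual.toWeakDual (WeakDual.toStrongDual η ∘L A)
  map_add' _ _ := rfl
  map_smul' _ _ := rfl
  cont := WeakDual.continuous_of_continuous_eval fun v => WeakDual.eval_continuous (A v)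

/-- In the dual of a reflexive space the norm closure and the weak-star closure of a convex set
coincide. -/
theorem toWeakDual_image_closure
    (hV : Function.Surjective (NormedSpace.inclusionInDoubleDual ℂ V))
    {C : Set (StrongDual ℂ V)} (hC : Convex ℝ C) :
    (StrongDual.toWeakDual : StrongDual ℂ V ≃ₗ[ℂ] WeakDual ℂ V) '' closure C =
      closure ((StrongDual.toWeakDual : StrongDual ℂ V ≃ₗ[ℂ] WeakDual ℂ V) '' C) := by
  -- By Hahn–Banach the closure of a convex set depends only on the continuous functionals. The two
  -- topologies have the same ones, since by reflexivity every bidual element is evaluation at a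
  -- vector.
  refine LinearEquiv.image_closure_of_convex hC _
    (fun f => f.continuous.comp NormedSpace.Dual.toWeakDual_continuous) fun f => ?_
  obtain ⟨v, rfl⟩ := hV f
  exact WeakDual.eval_continuous v

/-- A finite family of transposes acting isometrically on a weak-star compact convex set in the
dual of a reflexive space has a common fixed point. -/
theorem exists_fixedPoint_of_finite
    (hV : Function.Surjective (NormedSpace.inclusionInDoubleDual ℂ V))
    {K : Set (WeakDual ℂ V)} (hK : IsCompact K) (hKc : Convex ℝ K) (hKne : K.Nonempty)
    {ι : Type*} (A : ι → V →L[ℂ] V) (F : Finset ι)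
    (hAK : ∀ i, MapsTo (weakTranspose (A i)) K K)
    (hAd : ∀ i, ∀ η ∈ K, ∀ θ ∈ K,
      ‖WeakDual.toStrongDual (weakTranspose (A i) η - weakTranspose (A i) θ)‖ =
        ‖WeakDual.toStrongDual (η - θ)‖) :
    ∃ η ∈ K, ∀ i ∈ F, weakTranspose (A i) η = η := by
  set S : Submonoid (WeakDual ℂ V →L[ℝ] WeakDual ℂ V) :=
    Submonoid.closure ((fun i => weakTranspose (A i)) '' F) with hS
  -- Finiteness of the family enters here: the monoid it generates is countable, so orbits are
  -- countable.
  have hScount : (S : Set (WeakDual ℂ V →L[ℝ] WeakDual ℂ V)).Countable := by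
    have : Countable ((fun i => weakTranspose (A i)) '' (F : Set ι)) :=
      (F.countable_toSet.image _).to_subtype
    rw [hS, Submonoid.closure_eq_mrange, MonoidHom.coe_mrange]
    have : Countable (FreeMonoid ((fun i => weakTranspose (A i)) '' (F : Set ι))) :=
      inferInstanceAs (Countable (List _))
    exact Set.countable_range _
  have hSK : ∀ s ∈ S, MapsTo s K K ∧ ∀ η ∈ K, ∀ θ ∈ K,
      ‖WeakDual.toStrongDual (s η - s θ)‖ = ‖WeakDual.toStrongDual (η - θ)‖ := by
    intro s hs
    induction hs using Submonoid.closure_induction with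
    | mem s hs =>
      obtain ⟨i, -, rfl⟩ := hs
      exact ⟨hAK i, hAd i⟩
    | one => exact ⟨fun _ h => h, fun _ _ _ _ => rfl⟩
    | mul s t _ _ hs ht =>
      exact ⟨hs.1.comp ht.1, fun η hη θ hθ =>
        (hs.2 _ (ht.1 hη) _ (ht.1 hθ)).trans (ht.2 η hη θ hθ)⟩
  obtain ⟨η₀, hη₀⟩ := hKne
  set O : Set (WeakDual ℂ V) := (fun s : WeakDual ℂ V →L[ℝ] WeakDual ℂ V => s η₀) '' S with hO
  have hOS : ∀ s ∈ S, MapsTo s O O := by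
    rintro s hs _ ⟨t, ht, rfl⟩
    exact ⟨s * t, S.mul_mem hs ht, rfl⟩
  -- Cutting `K` down to the closed hull of one countable orbit gives the norm separability that the
  -- Baire argument needs.
  set L : Set (WeakDual ℂ V) := K ∩ closure (convexHull ℝ O) with hL
  have hLS : ∀ s ∈ S, MapsTo s L L := fun s hs η hη =>
    ⟨(hSK s hs).1 hη.1, MapsTo.closure (fun y hy => by
      have h1 : s y ∈ (s : WeakDual ℂ V →ₗ[ℝ] WeakDual ℂ V) '' convexHull ℝ O := ⟨y, hy, rfl⟩
      rw [LinearMap.image_convexHull] at h1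
      exact convexHull_mono (hOS s hs).image_subset h1) s.continuous hη.2⟩
  have hOsep : TopologicalSpace.IsSeparable
      (closure (convexHull ℝ ((WeakDual.toStrongDual : WeakDual ℂ V ≃ₗ[ℂ] StrongDual ℂ V) '' O))) :=
    (((hScount.image _).image _).isSeparable.span (R := ℝ)).closure.mono
      (closure_mono (convexHull_min Submodule.subset_span
        (Submodule.span ℝ _).convex))
  obtain ⟨D, hD, hDO⟩ := hOsep
  have hRN := exists_fixedPoint_of_isometric (K := L)
  obtain ⟨η, hη, hfix⟩ := hRN
    (hK.inter_right isClosed_closure) (hKc.inter (WeakDual.convex_closure (convex_convexHull ℝ O)))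
    ⟨η₀, hη₀, subset_closure (subset_convexHull ℝ _ ⟨1, S.one_mem, rfl⟩)⟩ S hLS
    (fun η θ => ‖WeakDual.toStrongDual (η - θ)‖)
    (fun η θ h => by simpa [sub_eq_zero] using h)
    (fun η θ => by rw [map_sub, map_sub]; exact norm_sub_rev _ _)
    (fun η θ ζ => by simp only [map_sub]; exact norm_sub_le_norm_sub_add_norm_sub _ _ _)
    (fun s hs η hη θ hθ => (hSK s hs).2 η hη.1 θ hθ.1)
    (fun η r => by
      convert WeakDual.isClosed_closedBall (WeakDual.toStrongDual η) r using 1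
      ext θ
      simp only [mem_ofPred_eq, mem_preimage, Metric.mem_closedBall, dist_eq_norm, map_sub]
      rw [norm_sub_rev])
    (fun ε hε => ⟨StrongDual.toWeakDual '' D, hD.image _, fun η hη => by
      -- The hull was closed in the weak-star topology, but separability is known for the norm
      -- closure; reflexivity identifies the two.
      have h1 : η ∈ closure (StrongDual.toWeakDual '' convexHull ℝ
          ((WeakDual.toStrongDual : WeakDual ℂ V ≃ₗ[ℂ] StrongDual ℂ V) '' O)) := by
        refine closure_mono ?_ hη.2
        refine convexHull_min (fun θ hθ => ⟨_, subset_convexHull ℝ _ ⟨θ, hθ, rfl⟩, rfl⟩) ?_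
        exact (convex_convexHull ℝ _).is_linear_image
          (f := fun x => StrongDual.toWeakDual x) ⟨fun _ _ => rfl, fun _ _ => rfl⟩
      rw [← toWeakDual_image_closure hV (convex_convexHull ℝ _)] at h1
      obtain ⟨θ, hθ, rfl⟩ := h1
      obtain ⟨ζ, hζ, hd⟩ := Metric.mem_closure_iff.1 (hDO hθ) ε hε
      refine ⟨_, ⟨ζ, hζ, rfl⟩, ?_⟩
      rw [dist_comm, dist_eq_norm] at hd
      exact hd.le⟩)
  exact ⟨η, hη.1, fun i hi => hfix _ (Submonoid.subset_closure ⟨i, hi, rfl⟩)⟩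

/-- A family of transposes acting isometrically on a weak-star compact convex set in the
dual of a reflexive space has a common fixed point. -/
theorem exists_fixedPoint_of_reflexive
    (hV : Function.Surjective (NormedSpace.inclusionInDoubleDual ℂ V))
    {K : Set (WeakDual ℂ V)} (hK : IsCompact K) (hKc : Convex ℝ K) (hKne : K.Nonempty)
    {ι : Type*} (A : ι → V →L[ℂ] V)
    (hAK : ∀ i, MapsTo (weakTranspose (A i)) K K)
    (hAd : ∀ i, ∀ η ∈ K, ∀ θ ∈ K,
      ‖WeakDual.toStrongDual (weakTranspose (A i) η - weakTranspose (A i) θ)‖ =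
        ‖WeakDual.toStrongDual (η - θ)‖) :
    ∃ η ∈ K, ∀ i, weakTranspose (A i) η = η := by
  -- The fixed point sets are weak-star closed, so compactness reduces to finite subfamilies.
  obtain ⟨η, hη, hη'⟩ := hK.inter_iInter_nonempty
    (fun i => {η | weakTranspose (A i) η = η})
    (fun i => isClosed_eq (weakTranspose (A i)).continuous continuous_id) fun F => by
      obtain ⟨η, hη, hF⟩ := exists_fixedPoint_of_finite hV hK hKc hKne A F hAK hAd
      exact ⟨η, hη, mem_iInter₂.2 hF⟩
  exact ⟨η, hη, fun i => mem_iInter.1 hη' i⟩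

end Reflexive

/-! ### Common norming vectors -/

section Support

variable {V : Type v} [NormedAddCommGroup V] [NormedSpace ℂ V]

/-- A convex set contained in a sphere of the dual of a reflexive space is contained in a face
exposed by a vector. -/
theorem exists_forall_apply_eq_norm_mul
    (hV : Function.Surjective (NormedSpace.inclusionInDoubleDual ℂ V))
    {K : Set (StrongDual ℂ V)} (hK : Convex ℝ K) (hKne : K.Nonempty) {r : ℝ} (hr : 0 < r)
    (hKr : ∀ η ∈ K, ‖η‖ = r) :
    ∃ v : V, v ≠ 0 ∧ ∀ η ∈ K, η v = ((r * ‖v‖ : ℝ) : ℂ) := by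
  -- Separate `K` from the open ball of radius `r`. The supremum of the real part over the ball is
  -- `r‖v‖`, so on `K` it is at least `r‖v‖`, while the modulus is at most that.
  obtain ⟨f, u, hfb, hfK⟩ := RCLike.geometric_hahn_banach_open (𝕜 := ℂ)
    (convex_ball (0 : StrongDual ℂ V) r) Metric.isOpen_ball hK
    (Set.disjoint_left.2 fun η hη hηK => by
      rw [mem_ball_zero_iff, hKr η hηK] at hη
      exact lt_irrefl _ hη)
  obtain ⟨v, rfl⟩ := hV f
  simp only [NormedSpace.dual_def, RCLike.re_eq_complex_re] at hfb hfK
  have hu : r * ‖v‖ ≤ u := by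
    obtain ⟨g, hg1, hgv⟩ := exists_dual_vector'' ℂ v
    -- The ball is open, so a norming functional is scaled by `s < r` and then `s` tends to `r`.
    have hlt : ∀ s ∈ Ico 0 r, s * ‖v‖ ≤ u := fun s hs => by
      have := hfb ((s : ℂ) • g) (by
        rw [mem_ball_zero_iff, norm_smul, Complex.norm_real, Real.norm_of_nonneg hs.1]
        nlinarith [hs.2, hs.1, norm_nonneg g])
      simp only [smul_apply, smul_eq_mul, hgv] at this
      simpa using this.le
    have hmem : r ∈ closure (Ico 0 r) := by
      rw [closure_Ico hr.ne]; exact ⟨hr.le, le_rfl⟩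
    exact closure_minimal hlt 
      (isClosed_le (continuous_id.mul continuous_const) continuous_const) hmem
  have h0 : 0 < u := by simpa using hfb 0 (by simpa using hr)
  refine ⟨v, ?_, fun η hη => ?_⟩
  · rintro rfl
    obtain ⟨η, hη⟩ := hKne
    have := hfK η hη
    simp at this
    linarith
  · have h1 : ‖η v‖ ≤ r * ‖v‖ := by rw [← hKr η hη]; exact η.le_opNorm v
    have h2 := hfK η hη
    have h3 := Complex.re_le_norm (η v)
    have h4 : (η v).re = r * ‖v‖ := by linarith
    have h5 : ‖η v‖ = r * ‖v‖ := by linarith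
    have h6 := Complex.sq_norm (η v)
    rw [Complex.normSq_apply, h5, h4] at h6
    refine Complex.ext (by simpa using h4) ?_
    rw [Complex.ofReal_im]
    nlinarith

end Support

/-! ### Rows of operators on `ℓ₂(V)` -/

section Ell2

variable {V : Type v} [NormedAddCommGroup V] [NormedSpace ℂ V] {ι : Type w}

open Classical in
/-- If `η` composed with a diagonal entry of a contraction of `ℓ₂(V)` attains its norm, then
`η` annihilates the other entries of that row. -/
theorem apply_single_eq_zero_of_norming
    {U : lp (fun _ : ι => V) 2 →L[ℂ] lp (fun _ : ι => V) 2} (hU : ∀ z, ‖U z‖ ≤ ‖z‖)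
    {η : StrongDual ℂ V} {β : ι} {v₀ : V} (hv₀ : v₀ ≠ 0)
    (hη : η (U (lp.single 2 β v₀) β) = ((‖η‖ * ‖v₀‖ : ℝ) : ℂ)) {α : ι} (hα : α ≠ β) (v : V) :
    η (U (lp.single 2 α v) β) = 0 := by
  set c := η (U (lp.single 2 α v) β) with hc
  have hbound : ∀ z, ‖η (U z β)‖ ≤ ‖η‖ * ‖z‖ := fun z =>
    (η.le_opNorm _).trans (mul_le_mul_of_nonneg_left
      ((lp.norm_apply_le_norm two_ne_zero _ _).trans (hU z)) (norm_nonneg _))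
  have hnorm : ∀ a : V, ‖lp.single (E := fun _ : ι => V) 2 β v₀ + lp.single 2 α a‖ ^ 2 = ‖v₀‖ ^ 2 + ‖a‖ ^ 2 := by
    intro a
    have := lp.norm_sum_single (p := 2) (E := fun _ : ι => V) (by norm_num)
      (Function.update (Function.update 0 α a) β v₀) {β, α}
    rw [Finset.sum_pair hα.symm, Finset.sum_pair hα.symm, Function.update_self,
      Function.update_of_ne hα, Function.update_self] at this
    simpa using this
  by_contra hc0
  have hηp : 0 < ‖η‖ := by
    rcases (norm_nonneg η).eq_or_lt with h | h
    · exact absurd (by rw [hc, norm_eq_zero.1 h.symm]; rfl) hc0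
    · exact h
  have hR : 0 < ‖v₀‖ := norm_pos_iff.2 hv₀
  have hcp : 0 < ‖c‖ := norm_pos_iff.2 hc0
  -- Perturb `v₀` by `s · conj c · v` in coordinate `α`: the value grows by `s‖c‖²`, but the squared
  -- norm only by `s²‖c‖²‖v‖²`. Squaring the contraction bound and dividing by `s‖c‖²` gives this
  -- inequality, which fails for small `s`.
  have hineq : ∀ s : ℝ, 0 < s → 2 * (‖η‖ * ‖v₀‖) ≤ s * (‖η‖ ^ 2 * ‖v‖ ^ 2) := by
    intro s hs
    set t : ℂ := s * starRingEnd ℂ c with ht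
    have h1 := hbound (lp.single 2 β v₀ + lp.single 2 α (t • v))
    have hval : η (U (lp.single 2 β v₀ + lp.single 2 α (t • v)) β) =
        ((‖η‖ * ‖v₀‖ + s * ‖c‖ ^ 2 : ℝ) : ℂ) := by
      rw [map_add, lp.coeFn_add, Pi.add_apply, map_add, hη, lp.single_smul, map_smul,
        lp.coeFn_smul, Pi.smul_apply, map_smul, ← hc, smul_eq_mul, ht, mul_assoc,
        mul_comm _ c, Complex.mul_conj, Complex.normSq_eq_norm_sq]
      push_cast
      ring
    rw [hval, Complex.norm_real, Real.norm_of_nonneg (by positivity)] at h1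
    have h2 := pow_le_pow_left₀ (by positivity) h1 2
    rw [mul_pow, hnorm, norm_smul, ht, norm_mul, RCLike.norm_conj, Complex.norm_real,
      Real.norm_of_nonneg hs.le] at h2
    have h3 : s * ‖c‖ ^ 2 * (2 * (‖η‖ * ‖v₀‖)) ≤
        s * ‖c‖ ^ 2 * (s * (‖η‖ ^ 2 * ‖v‖ ^ 2)) := by
      nlinarith [sq_nonneg (s * ‖c‖ ^ 2)]
    exact le_of_mul_le_mul_left h3 (by positivity)
  -- For this `s` the right side is below `‖η‖‖v₀‖`; the `+ 1` covers `v = 0`.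
  have h1 := hineq (‖v₀‖ / (‖η‖ * (‖v‖ ^ 2 + 1))) (by positivity)
  rw [div_mul_eq_mul_div, le_div_iff₀ (by positivity)] at h1
  have h2 : 0 < ‖v₀‖ * ‖η‖ ^ 2 := by positivity
  nlinarith [mul_nonneg h2.le (sq_nonneg ‖v‖)]

open Classical in
/-- A functional annihilating the off-diagonal entries of a row only sees the diagonal entry. -/
theorem apply_eq_apply_single {U : lp (fun _ : ι => V) 2 →L[ℂ] lp (fun _ : ι => V) 2}
    {η : StrongDual ℂ V} {β : ι} (hη : ∀ α ≠ β, ∀ v, η (U (lp.single 2 α v) β) = 0)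
    (z : lp (fun _ : ι => V) 2) : η (U z β) = η (U (lp.single 2 β (z β)) β) := by
  have h1 := (lp.hasSum_single (by norm_num : (2 : ENNReal) ≠ ⊤) z).mapL
    (η ∘L lp.evalCLM ℂ (fun _ : ι => V) 2 β ∘L U)
  exact h1.unique (hasSum_single β fun α hα => hη α hα _)

open Classical in
/-- For a functional annihilating the off-diagonal entries of a row of an isometric bijection,
composition with the diagonal entry preserves the norm. -/
theorem norm_comp_diagonal {U : lp (fun _ : ι => V) 2 →L[ℂ] lp (fun _ : ι => V) 2}
    (hU : ∀ z, ‖U z‖ = ‖z‖) (hUs : Function.Surjective U)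
    {η : StrongDual ℂ V} {β : ι} (hη : ∀ α ≠ β, ∀ v, η (U (lp.single 2 α v) β) = 0)
    {A : V →L[ℂ] V} (hA : ∀ v, U (lp.single 2 β v) β = A v) : ‖η ∘L A‖ = ‖η‖ := by
  have heval : ∀ (z : lp (fun _ : ι => V) 2) β, ‖z β‖ ≤ ‖z‖ := fun z β =>
    lp.norm_apply_le_norm two_ne_zero _ _
  apply le_antisymm
  · refine ContinuousLinearMap.opNorm_le_bound _ (norm_nonneg _) fun v => ?_
    rw [ContinuousLinearMap.comp_apply, ← hA]
    refine (η.le_opNorm _).trans (mul_le_mul_of_nonneg_left ((heval _ _).trans ?_) (norm_nonneg _))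
    rw [hU, lp.norm_single (by norm_num)]
  · refine ContinuousLinearMap.opNorm_le_bound _ (norm_nonneg _) fun v => ?_
    -- The preimage `z` has norm `‖v‖`, and `η` sees only `A (z β)` in row `β`, so `η v` is a value
    -- of `η ∘ A` at a vector of norm at most `‖v‖`.
    obtain ⟨z, hz⟩ := hUs (lp.single 2 β v)
    have h1 : η v = (η ∘L A) (z β) := by
      rw [ContinuousLinearMap.comp_apply, ← hA, ← apply_eq_apply_single hη, hz,
        lp.single_apply_self]
    rw [h1]
    refine (ContinuousLinearMap.le_opNorm _ _).trans
      (mul_le_mul_of_nonneg_left ((heval _ _).trans ?_) (norm_nonneg _))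
    rw [← hU, hz, lp.norm_single (by norm_num)]

end Ell2

/-! ### Norm estimates and slices in von Neumann algebras -/

namespace HopfVN

section VN

variable {E : Type u} [NormedAddCommGroup E] [InnerProductSpace ℂ E] [CompleteSpace E]
variable {F : Type u} [NormedAddCommGroup F] [InnerProductSpace ℂ F] [CompleteSpace F]
variable {M : VonNeumannAlgebra E} {Q : VonNeumannAlgebra F}

theorem norm_vecPredual_le (M : VonNeumannAlgebra E) (k h : E) :
    ‖vecPredual M k h‖ ≤ ‖k‖ * ‖h‖ := by
  refine ContinuousLinearMap.opNorm_le_bound _ (by positivity) fun x => ?_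
  change ‖⟪k, (x : E →L[ℂ] E) h⟫_ℂ‖ ≤ _
  calc ‖⟪k, (x : E →L[ℂ] E) h⟫_ℂ‖ ≤ ‖k‖ * (‖(x : E →L[ℂ] E)‖ * ‖h‖) :=
        (norm_inner_le_norm _ _).trans (by gcongr; exact ContinuousLinearMap.le_opNorm _ _)
    _ = ‖k‖ * ‖h‖ * ‖x‖ := by rw [show ‖x‖ = ‖(x : E →L[ℂ] E)‖ from rfl]; ring

/-- The predual norms the von Neumann algebra. -/
theorem norm_le_of_forall_predual (y : Elem M) {C : ℝ} (hC : 0 ≤ C)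
    (h : ∀ ν : predual M, ‖ν.1 y‖ ≤ C * ‖ν‖) : ‖y‖ ≤ C := by
  change ‖(y : E →L[ℂ] E)‖ ≤ C
  refine ContinuousLinearMap.opNorm_le_bound _ hC fun v => ?_
  -- Testing against this functional gives `‖y v‖² ≤ C ‖y v‖ ‖v‖`.
  have h1 := h (vecPredual M ((y : E →L[ℂ] E) v) v)
  have h2 : ‖vecPredual M ((y : E →L[ℂ] E) v) v‖ ≤ ‖(y : E →L[ℂ] E) v‖ * ‖v‖ :=
    norm_vecPredual_le M _ _
  have h3 : (vecPredual M ((y : E →L[ℂ] E) v) v).1 y =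
      ⟪(y : E →L[ℂ] E) v, (y : E →L[ℂ] E) v⟫_ℂ := rfl
  rw [h3, inner_self_eq_norm_sq_to_K] at h1
  simp only [norm_pow, RCLike.norm_ofReal, abs_norm] at h1
  rcases (norm_nonneg ((y : E →L[ℂ] E) v)).eq_or_lt with h0 | h0
  · rw [← h0]; positivity
  · have h4 := h1.trans (mul_le_mul_of_nonneg_left h2 hC)
    exact le_of_mul_le_mul_left (by nlinarith) h0

/-- Star homomorphisms of von Neumann algebras are contractive. -/
theorem VNHom.norm_apply_le (f : VNHom M Q) (x : Elem M) : ‖f x‖ ≤ ‖x‖ := by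
  let _ : CStarAlgebra (Elem M) :=
    StarSubalgebra.cstarAlgebra M.toStarSubalgebra (h_closed := isClosed_coe M)
  let _ : CStarAlgebra (Elem Q) :=
    StarSubalgebra.cstarAlgebra Q.toStarSubalgebra (h_closed := isClosed_coe Q)
  exact NonUnitalStarAlgHom.norm_apply_le f x

theorem elemTensor_one : elemTensor (1 : Elem M) (1 : Elem Q) = 1 :=
  Subtype.ext (vecTensor_ext fun _ _ => opTensor_vecTensor _ _ _ _)

theorem completeSpace_elem : CompleteSpace (Elem M) :=
  (isClosed_coe M).completeSpace_coe

/-- An operator in the tensor product all of whose slices `(μ ⊗ id)(T)` are `μ(1) y` is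
`1 ⊗ y`. -/
theorem eq_elemTensor_one_of_slice {T : Elem (vnTensor M Q)} {y : Elem Q}
    (h : ∀ μ : predual M, slice μ T = μ.1 1 • y) : T = elemTensor 1 y := by
  have key : ∀ k h' x v, ⟪vecTensor k x, T.1 (vecTensor h' v)⟫_ℂ =
      ⟪vecTensor k x, (elemTensor (1 : Elem M) y).1 (vecTensor h' v)⟫_ℂ := by
    intro k h' x v
    have h1 : ⟪x, (slice (vecPredual M k h') T : F →L[ℂ] F) v⟫_ℂ =
        ⟪vecTensor k x, T.1 (vecTensor h' v)⟫_ℂ :=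
      (inner_slice _ T x v).trans (inner_sliceR x v T k h')
    rw [← h1, h, ← slice_elemTensor]
    exact (inner_slice _ _ x v).trans (inner_sliceR x v _ k h')
  refine Subtype.ext (vecTensor_ext fun h' v => ?_)
  have h2 : (innerSL ℂ (T.1 (vecTensor h' v)) : HilbertTensor E F →L[ℂ] ℂ) =
      innerSL ℂ ((elemTensor (1 : Elem M) y).1 (vecTensor h' v)) :=
    vecTensor_ext fun k x => by
      rw [innerSL_apply_apply, innerSL_apply_apply, ← inner_conj_symm, key, inner_conj_symm]
  exact ext_inner_right ℂ fun z => congrArg (fun f : HilbertTensor E F →L[ℂ] ℂ => f z) h2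

end VN

/-! ### Normal states and matrix entries of a generator -/

namespace HopfVonNeumannAlgebra

variable {H : Type u} [NormedAddCommGroup H] [InnerProductSpace ℂ H] [CompleteSpace H]
variable {M : HopfVonNeumannAlgebra H}

theorem norm_conv_le (μ ν : M.Pre) : ‖conv μ ν‖ ≤ ‖μ‖ * ‖ν‖ := by
  refine ContinuousLinearMap.opNorm_le_bound _ (by positivity) fun x => ?_
  calc ‖(conv μ ν).1 x‖ = ‖ν.1 (slice μ (M.comul x))‖ := by rw [conv_apply]; rfl
    _ ≤ ‖ν‖ * (‖μ‖ * ‖x‖) := by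
        refine (ν.1.le_opNorm _).trans (mul_le_mul_of_nonneg_left ?_ (norm_nonneg _))
        exact (norm_slice_le _ _).trans
          (mul_le_mul_of_nonneg_left (VNHom.norm_apply_le _ _) (norm_nonneg _))
    _ = ‖μ‖ * ‖ν‖ * ‖x‖ := by ring

/-- Unitality of `Δ` makes `P` a semigroup; this is what makes the averaged functionals an invariant
set. -/
theorem conv_mem_normalStates {μ ν : M.Pre} (hμ : μ ∈ M.normalStates)
    (hν : ν ∈ M.normalStates) : conv μ ν ∈ M.normalStates := by
  refine ⟨(norm_conv_le μ ν).trans (mul_le_one₀ hμ.1 (norm_nonneg _) hν.1), ?_⟩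
  rw [conv_apply, map_one, ← elemTensor_one, tensorPredual_elemTensor, hμ.2, hν.2, one_mul]

theorem convex_normalStates : Convex ℝ M.normalStates := by
  intro μ hμ ν hν a b ha hb hab
  refine ⟨?_, ?_⟩
  · refine (norm_add_le _ _).trans ?_
    rw [norm_smul, norm_smul, Real.norm_of_nonneg ha, Real.norm_of_nonneg hb]
    nlinarith [hμ.1, hν.1]
  · have : (a • μ + b • ν).1 1 = a • μ.1 1 + b • ν.1 1 := rfl
    rw [this, hμ.2, hν.2, ← add_smul, hab, one_smul]

theorem vecPredual_mem_normalStates {k : H} (hk : ‖k‖ = 1) :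
    vecPredual M.alg k k ∈ M.normalStates := by
  refine ⟨(norm_vecPredual_le _ k k).trans (by rw [hk, one_mul]), ?_⟩
  change ⟪k, k⟫_ℂ = 1
  rw [inner_self_eq_norm_sq_to_K, hk]
  simp

section Rep

variable {ι : Type w} {b : HilbertBasis ι ℂ H}
variable {V : Type v} [NormedAddCommGroup V] [NormedSpace ℂ V]

open Classical in
/-- The entries of the matrix of a generator. -/
theorem IsGenerator.apply_single {π : M.Pre →L[ℂ] (V →L[ℂ] V)} {U : ell2 ι V →L[ℂ] ell2 ι V}
    (hU : M.IsGenerator b π U) (α β : ι) (v : V) :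
    U (lp.single 2 α v) β = π (vecPredual M.alg (b β) (b α)) v := by
  have hsingle : ellTensor b (b α) v = lp.single (E := fun _ : ι => V) 2 α v := by
    refine lp.ext (funext fun i => ?_)
    change b.repr (b α) i • v = _
    rw [b.repr_self, lp.single_apply, lp.single_apply]
    by_cases h : i = α
    · subst h; simp
    · simp [h]
  refine (SeparatingDual.eq_iff_forall_dual_eq (R := ℂ)).2 fun η => ?_
  have h1 := hU (b α) (b β) v η
  rw [hsingle] at h1
  rw [← (hasSum_single β fun i hi => ?_).unique h1]
  · simp [b.repr_self]
  · simp [b.repr_self, hi]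

end Rep

end HopfVonNeumannAlgebra

end HopfVN

/-! ### Averaging a functional to an invariant one -/

namespace HopfVN.HopfVonNeumannAlgebra

variable {H : Type u} [NormedAddCommGroup H] [InnerProductSpace ℂ H] [CompleteSpace H]
variable {M : HopfVonNeumannAlgebra H}
variable {ι : Type w} {b : HilbertBasis ι ℂ H}
variable {V : Type v} [NormedAddCommGroup V] [NormedSpace ℂ V]

/-- In a nonempty weak-star compact convex set of functionals invariant under the normal states
there is a minimal one, and it is contained in a sphere. -/
theorem exists_minimal_invariant {π : M.Pre →L[ℂ] (V →L[ℂ] V)} (hπ : ‖π‖ ≤ 1)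
    {K : Set (WeakDual ℂ V)} (hK : IsCompact K) (hKc : Convex ℝ K) (hKne : K.Nonempty)
    (hKπ : ∀ μ ∈ M.normalStates, MapsTo (weakTranspose (π μ)) K K) :
    ∃ L ⊆ K, L.Nonempty ∧ IsCompact L ∧ Convex ℝ L ∧
      (∀ μ ∈ M.normalStates, MapsTo (weakTranspose (π μ)) L L) ∧
      ∃ r, ∀ η ∈ L, ‖WeakDual.toStrongDual η‖ = r := by
  obtain ⟨L, hLK, hLne, hLcl, ⟨hLc, hLπ⟩, hLmin⟩ := exists_minimal_closed_subset
    (fun t : Set (WeakDual ℂ V) => Convex ℝ t ∧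
      ∀ μ ∈ M.normalStates, MapsTo (weakTranspose (π μ)) t t)
    (fun F _ h => ⟨convex_sInter fun t ht => (h t ht).1, fun μ hμ x hx t ht =>
      (h t ht).2 μ hμ (hx t ht)⟩) hK hKne ⟨hKc, hKπ⟩
  have hle : ∀ η ∈ L, ∀ θ ∈ L, ‖WeakDual.toStrongDual θ‖ ≤ ‖WeakDual.toStrongDual η‖ := by
    intro η hη θ hθ
    -- The norm ball of radius `‖η‖` is convex, weak-star closed and invariant under transposes of
    -- contractions, so minimality puts all of `L` inside it.
    set B : Set (WeakDual ℂ V) :=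
      WeakDual.toStrongDual ⁻¹' Metric.closedBall 0 ‖WeakDual.toStrongDual η‖ with hB
    have hBc : Convex ℝ B := (convex_closedBall _ _).is_linear_preimage
      (f := fun x : WeakDual ℂ V => WeakDual.toStrongDual x) ⟨fun _ _ => rfl, fun _ _ => rfl⟩
    have hLB := hLmin (L ∩ B) inter_subset_left ⟨η, hη, by simp [hB]⟩
      (hLcl.inter (WeakDual.isClosed_closedBall _ _)) ⟨hLc.inter hBc, fun μ hμ ζ hζ =>
        ⟨hLπ μ hμ hζ.1, by
          have h1 := hζ.2
          rw [hB, mem_preimage, mem_closedBall_zero_iff] at h1 ⊢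
          refine (ContinuousLinearMap.opNorm_comp_le _ _).trans ?_
          have h2 : ‖π μ‖ ≤ 1 := (π.le_opNorm μ).trans (mul_le_one₀ hπ (norm_nonneg _) hμ.1)
          exact (mul_le_of_le_one_right (norm_nonneg _) h2).trans h1⟩⟩
    rw [← hLB] at hθ
    simpa [hB] using hθ.2
  obtain ⟨η, hη⟩ := hLne
  exact ⟨L, hLK, ⟨η, hη⟩, hK.of_isClosed_subset hLcl hLK, hLc, hLπ, ‖WeakDual.toStrongDual η‖,
    fun θ hθ => le_antisymm (hle η hη θ hθ) (hle θ hθ η hη)⟩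

/-- The vector functional `μ_{kh}` as a bounded linear function of `h`. -/
def vecPredualRight (M : HopfVonNeumannAlgebra H) (k : H) : H →L[ℂ] M.Pre :=
  LinearMap.mkContinuous
    { toFun := fun h => vecPredual M.alg k h
      map_add' := fun h h' => Subtype.ext (ContinuousLinearMap.ext fun x => by
        change ⟪k, x.1 (h + h')⟫_ℂ = ⟪k, x.1 h⟫_ℂ + ⟪k, x.1 h'⟫_ℂ
        rw [map_add, inner_add_right])
      map_smul' := fun c h => Subtype.ext (ContinuousLinearMap.ext fun x => by
        change ⟪k, x.1 (c • h)⟫_ℂ = c • ⟪k, x.1 h⟫_ℂ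
        rw [map_smul, inner_smul_right, smul_eq_mul]) }
    ‖k‖ (fun h => norm_vecPredual_le M.alg k h)

/-- The vector functional `μ_{kh}` as a bounded conjugate linear function of `k`. -/
def vecPredualLeft (M : HopfVonNeumannAlgebra H) (h : H) : H →L⋆[ℂ] M.Pre :=
  LinearMap.mkContinuous
    { toFun := fun k => vecPredual M.alg k h
      map_add' := fun k k' => Subtype.ext (ContinuousLinearMap.ext fun x => by
        change ⟪k + k', x.1 h⟫_ℂ = ⟪k, x.1 h⟫_ℂ + ⟪k', x.1 h⟫_ℂ
        rw [inner_add_left])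
      map_smul' := fun c k => Subtype.ext (ContinuousLinearMap.ext fun x => by
        change ⟪c • k, x.1 h⟫_ℂ = starRingEnd ℂ c • ⟪k, x.1 h⟫_ℂ
        rw [inner_smul_left, smul_eq_mul]) }
    ‖h‖ (fun k => (norm_vecPredual_le M.alg k h).trans_eq (mul_comm _ _))

/-- A bounded linear map on the predual vanishing on the `μ_{kh}` with `k, h` in a basis is
zero. -/
theorem eq_zero_of_forall_basis {G : Type*} [NormedAddCommGroup G] [NormedSpace ℂ G]
    (b : HilbertBasis ι ℂ H) (D : M.Pre →L[ℂ] G)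
    (hD : ∀ α β, D (vecPredual M.alg (b β) (b α)) = 0) : D = 0 := by
  have hdense : Dense (Submodule.span ℂ (range b) : Set H) :=
    Submodule.dense_iff_topologicalClosure_eq_top.2 b.dense_span
  have h1 : ∀ β h, D (vecPredual M.alg (b β) h) = 0 := fun β h => by
    have : D ∘L vecPredualRight M (b β) = 0 := ContinuousLinearMap.ext_on hdense (by
      rintro _ ⟨α, rfl⟩; exact hD α β)
    exact congrArg (fun f : H →L[ℂ] G => f h) this
  have h2 : ∀ k h, D (vecPredual M.alg k h) = 0 := fun k h => by
    have : D.comp (vecPredualLeft M h) = 0 := ContinuousLinearMap.ext_on hdense (by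
      rintro _ ⟨β, rfl⟩; exact h1 β h)
    exact congrArg (fun f : H →L⋆[ℂ] G => f k) this
  -- The kernel of `D`, viewed in the full dual, is closed because the predual is closed there;
  -- containing the vector functionals, it is then all of the predual.
  have hcl : IsClosed (((LinearMap.ker (D : M.Pre →ₗ[ℂ] G)).map (predual M.alg).subtype :
      Submodule ℂ (StrongDual ℂ (Elem M.alg))) : Set (StrongDual ℂ (Elem M.alg))) := by
    rw [Submodule.map_coe]
    exact (Submodule.isClosed_topologicalClosure _).isClosedEmbedding_subtypeVal.isClosedMap _
      (isClosed_eq D.continuous continuous_const)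
  ext μ
  obtain ⟨ν, hν, hνμ⟩ := predual_le M.alg hcl
    (fun k h => ⟨vecPredual M.alg k h, h2 k h, rfl⟩) μ.2
  rw [← Subtype.ext hνμ]
  exact hν

/-- A functional is invariant under the normal functionals as soon as it is so under the `μ_{kh}`
with `k, h` in a basis. -/
theorem comp_eq_apply_one_smul {π : M.Pre →L[ℂ] (V →L[ℂ] V)} {η : StrongDual ℂ V}
    (hdiag : ∀ β, η ∘L π (vecPredual M.alg (b β) (b β)) = η)
    (hoff : ∀ α β, α ≠ β → η ∘L π (vecPredual M.alg (b β) (b α)) = 0) (μ : M.Pre) :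
    η ∘L π μ = μ.1 1 • η := by
  ext v
  -- Apply density to `μ ↦ η(π(μ) v) − μ(1) η(v)`, using that `μ_{βα}(1)` is the Kronecker delta.
  have h0 := eq_zero_of_forall_basis b
    (η ∘L (ContinuousLinearMap.apply ℂ V v) ∘L π -
      η v • (ContinuousLinearMap.apply ℂ ℂ (1 : M.El)) ∘L (predual M.alg).subtypeL)
    fun α β => by
      have h1 : (vecPredual M.alg (b β) (b α)).1 1 = ⟪b β, b α⟫_ℂ := rfl
      change (η ∘L π (vecPredual M.alg (b β) (b α))) v -
        η v * (vecPredual M.alg (b β) (b α)).1 1 = 0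
      rw [h1]
      by_cases h : α = β
      · subst h
        rw [hdiag, inner_self_eq_norm_sq_to_K, b.orthonormal.1 α]
        simp
      · rw [hoff α β h, b.orthonormal.2 (Ne.symm h)]
        simp
  have h2 := congrArg (fun f : M.Pre →L[ℂ] ℂ => f μ) h0
  change η (π μ v) - η v * μ.1 1 = 0 at h2
  change η (π μ v) = μ.1 1 * η v
  rw [sub_eq_zero.1 h2, mul_comm]

/-- A functional on the space of a representation having an isometric and onto generator can be
averaged, in norm, by normal states to an invariant functional. -/
theorem exists_invariant_mem_closure [Nontrivial H]
    (hV : IsReflexive V) {π : M.Pre →L[ℂ] (V →L[ℂ] V)} (hπ : ‖π‖ ≤ 1)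
    (hmul : ∀ μ ν, π (conv μ ν) = π μ ∘L π ν) {U : ell2 ι V →L[ℂ] ell2 ι V}
    (hU : M.IsGenerator b π U) (hUi : Isometry U) (hUs : Function.Surjective U)
    (η : StrongDual ℂ V) :
    ∃ η₀ ∈ closure ((fun μ => η ∘L π μ) '' M.normalStates), ∀ μ, η₀ ∘L π μ = μ.1 1 • η₀ := by
  classical
  have hUn : ∀ z, ‖U z‖ = ‖z‖ := fun z => hUi.norm_map_of_map_zero (map_zero U) z
  have hb : ∀ β, ‖b β‖ = 1 := fun β => b.orthonormal.1 β
  -- A basis vector supplies a normal state, which makes the orbit of `η` nonempty.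
  have hι : Nonempty ι := by
    by_contra h
    rw [not_nonempty_iff] at h
    obtain ⟨x, hx⟩ := exists_ne (0 : H)
    exact hx (b.repr.injective (lp.ext (funext fun i => h.elim i)))
  set C : Set (StrongDual ℂ V) := (fun μ => η ∘L π μ) '' M.normalStates with hC
  have hCc : Convex ℝ C := convex_normalStates.is_linear_image (f := fun μ => η ∘L π μ)
    ⟨fun μ ν => by rw [map_add, ContinuousLinearMap.comp_add], fun c μ => by
      ext v
      have : π (c • μ) = (c : ℂ) • π μ := π.map_smul (c : ℂ) μ
      rw [this]
      simp⟩
  have hCcl := toWeakDual_image_closure hV hCc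
  set K : Set (WeakDual ℂ V) :=
    (StrongDual.toWeakDual : StrongDual ℂ V ≃ₗ[ℂ] WeakDual ℂ V) '' closure C with hK
  have hKc : Convex ℝ K := hCc.closure.is_linear_image
    (f := fun x : StrongDual ℂ V => StrongDual.toWeakDual x) ⟨fun _ _ => rfl, fun _ _ => rfl⟩
  have hnorm : ∀ μ ∈ M.normalStates, ‖π μ‖ ≤ 1 := fun μ hμ =>
    (π.le_opNorm μ).trans (mul_le_one₀ hπ (norm_nonneg _) hμ.1)
  have hKcomp : IsCompact K := by
    have hCb : closure C ⊆ Metric.closedBall 0 ‖η‖ := by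
      refine closure_minimal ?_ Metric.isClosed_closedBall
      rintro _ ⟨μ, hμ, rfl⟩
      rw [mem_closedBall_zero_iff]
      exact (ContinuousLinearMap.opNorm_comp_le _ _).trans
        (mul_le_of_le_one_right (norm_nonneg _) (hnorm μ hμ))
    refine (WeakDual.isCompact_closedBall (0 : StrongDual ℂ V) ‖η‖).of_isClosed_subset
      (hCcl ▸ isClosed_closure) ?_
    rintro _ ⟨θ, hθ, rfl⟩
    exact hCb hθ
  have hKne : K.Nonempty :=
    ⟨_, _, subset_closure ⟨_, vecPredual_mem_normalStates (hb hι.some), rfl⟩, rfl⟩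
  have hKπ : ∀ μ ∈ M.normalStates, MapsTo (weakTranspose (π μ)) K K := by
    intro μ hμ
    rw [hCcl]
    refine MapsTo.closure ?_ (weakTranspose (π μ)).continuous
    rintro _ ⟨_, ⟨ν, hν, rfl⟩, rfl⟩
    -- Transposition reverses the order: `(η ∘ π ν) ∘ π μ = η ∘ π(νμ)`.
    exact ⟨_, ⟨conv ν μ, conv_mem_normalStates hν hμ, rfl⟩, by
      dsimp only; rw [hmul, ← ContinuousLinearMap.comp_assoc]; rfl⟩
  obtain ⟨L, hLK, hLne, hLcomp, hLc, hLπ, r, hLr⟩ :=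
    exists_minimal_invariant hπ hKcomp hKc hKne hKπ
  have hLdiag : ∀ β, MapsTo (weakTranspose (π (vecPredual M.alg (b β) (b β)))) L L :=
    fun β => hLπ _ (vecPredual_mem_normalStates (hb β))
  have hoff : ∀ θ ∈ L, ∀ β, ∀ α ≠ β, ∀ v, θ (U (lp.single 2 α v) β) = 0 := by
    intro θ hθ β α hα v
    have hr : 0 ≤ r := hLr θ hθ ▸ norm_nonneg _
    rcases hr.eq_or_lt with h0 | h0
    · have : WeakDual.toStrongDual θ = 0 := norm_eq_zero.1 ((hLr θ hθ).trans h0.symm)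
      rw [← WeakDual.toStrongDual_apply, this]; rfl
    · obtain ⟨v₀, hv₀, hLv⟩ := exists_forall_apply_eq_norm_mul hV
        (K := (WeakDual.toStrongDual : WeakDual ℂ V ≃ₗ[ℂ] StrongDual ℂ V) '' L)
        (WeakDual.convex_image_toStrongDual hLc) (hLne.image _) h0
        (by rintro _ ⟨θ, hθ, rfl⟩; exact hLr θ hθ)
      -- Both `θ` and `θ ∘ π(μ_{ββ})` lie in `L`, so the latter takes the value `‖θ‖‖v₀‖` at `v₀`.
      refine apply_single_eq_zero_of_norming (fun z => (hUn z).le)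
        (η := WeakDual.toStrongDual θ) hv₀ ?_ hα v
      rw [hU.apply_single, hLr θ hθ]
      exact hLv _ ⟨_, hLdiag β hθ, rfl⟩
  have hiso : ∀ β, ∀ θ ∈ L, ∀ ζ ∈ L,
      ‖WeakDual.toStrongDual (weakTranspose (π (vecPredual M.alg (b β) (b β))) θ -
        weakTranspose (π (vecPredual M.alg (b β) (b β))) ζ)‖ =
        ‖WeakDual.toStrongDual (θ - ζ)‖ := by
    intro β θ hθ ζ hζ
    -- Annihilation of the off-diagonal entries is linear in the functional, so it passes from `L`
    -- to the difference `θ - ζ`.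
    rw [← map_sub]
    exact norm_comp_diagonal (η := WeakDual.toStrongDual (θ - ζ)) hUn hUs
      (fun α hα v => by
        have h1 := hoff θ hθ β α hα v
        have h2 := hoff ζ hζ β α hα v
        rw [map_sub, sub_apply, WeakDual.toStrongDual_apply, WeakDual.toStrongDual_apply,
          h1, h2, sub_zero])
      (fun v => hU.apply_single β β v)
  obtain ⟨η₀, hη₀, hfix⟩ := exists_fixedPoint_of_reflexive hV hLcomp hLc hLne
    (fun β => π (vecPredual M.alg (b β) (b β))) hLdiag hiso
  obtain ⟨η₁, hη₁, rfl⟩ := hLK hη₀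
  refine ⟨η₁, hη₁, comp_eq_apply_one_smul (b := b) (fun β => hfix β) fun α β hαβ => ?_⟩
  ext v
  have := hoff _ hη₀ β α hαβ v
  rw [hU.apply_single] at this
  exact this

/-! ### From invariant functionals to invariant elements -/

/-- A coefficient of a left covariant representation whose functional can be averaged in norm to an
invariant functional has an invariant element in the closure of its right orbit. -/
theorem exists_comul_eq_mem_closure_rightOrbit
    {π : M.Pre →L[ℂ] (V →L[ℂ] V)} {ξ : M.Pre →L[ℂ] V} (hπξ : M.IsLeftCovariant π ξ)
    {x : M.El} {η : StrongDual ℂ V} (hx : M.IsCoefficient x ξ η) {η₀ : StrongDual ℂ V}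
    (hη₀ : η₀ ∈ closure ((fun μ => η ∘L π μ) '' M.normalStates))
    (hinv : ∀ μ, η₀ ∘L π μ = μ.1 1 • η₀) :
    ∃ y ∈ closure (M.rightOrbit x), M.comul y = elemTensor 1 y := by
  obtain ⟨θ, hθ, hlim⟩ := mem_closure_iff_seq_limit.1 hη₀
  choose μ hμ hμθ using hθ
  have hval : ∀ n (ν : M.Pre), ν.1 (rightAct x (μ n)) = θ n (ξ ν) := fun n ν => by
    rw [apply_rightAct, hx, hπξ.covariant, ← hμθ]
    rfl
  have := completeSpace_elem (M := M.alg)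
  -- The predual norms `M` and `ξ` is contractive, so distances in the orbit of `x` are at most
  -- those of the averaged functionals.
  have hcauchy : CauchySeq fun n => rightAct x (μ n) := by
    rw [Metric.cauchySeq_iff']
    intro ε hε
    obtain ⟨N, hN⟩ := Metric.cauchySeq_iff'.1 hlim.cauchySeq ε hε
    refine ⟨N, fun n hn => lt_of_le_of_lt ?_ (hN n hn)⟩
    rw [dist_eq_norm, dist_eq_norm]
    refine norm_le_of_forall_predual _ (norm_nonneg _) fun ν => ?_
    rw [map_sub, hval, hval, ← sub_apply]
    refine (ContinuousLinearMap.le_opNorm _ _).trans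
      (mul_le_mul_of_nonneg_left ?_ (norm_nonneg _))
    exact (ξ.le_opNorm ν).trans (mul_le_of_le_one_left (norm_nonneg _) hπξ.norm_cocycle_le)
  obtain ⟨y, hy⟩ := cauchySeq_tendsto_of_complete hcauchy
  -- The limit `y` is the coefficient of `ξ` at `η₀`; covariance and invariance of `η₀` then compute
  -- every slice of `Δ y`.
  have hyval : ∀ ν : M.Pre, ν.1 y = η₀ (ξ ν) := fun ν => by
    have h1 : Filter.Tendsto (fun n => ν.1 (rightAct x (μ n))) Filter.atTop (𝓝 (ν.1 y)) :=
      (ν.1.continuous.tendsto y).comp hy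
    have h2 : Filter.Tendsto (fun n => θ n (ξ ν)) Filter.atTop (𝓝 (η₀ (ξ ν))) :=
      ((ContinuousLinearMap.apply ℂ ℂ (ξ ν)).continuous.tendsto η₀).comp hlim
    simp only [hval] at h1
    exact tendsto_nhds_unique h1 h2
  refine ⟨y, mem_closure_of_tendsto hy (Filter.Eventually.of_forall fun n =>
    ⟨μ n, hμ n, rfl⟩), eq_elemTensor_one_of_slice fun ρ => ?_⟩
  refine sub_eq_zero.1 (norm_le_zero_iff.1 (norm_le_of_forall_predual _ le_rfl fun ν => ?_))
  have h1 : ν.1 (slice ρ (M.comul y)) = ρ.1 1 * ν.1 y := by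
    have h2 : ν.1 (slice ρ (M.comul y)) = (conv ρ ν).1 y := apply_rightAct y ρ ν
    rw [h2, hyval, hyval, hπξ.covariant, ← ContinuousLinearMap.comp_apply, hinv]
    rfl
  rw [map_sub, h1, map_smul, smul_eq_mul, sub_self, norm_zero, zero_mul]

end HopfVN.HopfVonNeumannAlgebra

end

theorem mainTheorem5 {H : Type u} [NormedAddCommGroup H] [InnerProductSpace ℂ H]
    [CompleteSpace H] [Nontrivial H] {ι : Type w} (b : HilbertBasis ι ℂ H)
    (M : HopfVN.HopfVonNeumannAlgebra H) (hM : M.RightNontrivial)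
    (x : M.El) (hx : x ∈ HopfVN.HopfVonNeumannAlgebra.WAPisoL.{u, v, w} M b) :
    ∃ c : ℂ, c • (1 : M.El) ∈ closure (M.rightOrbit x) := by
  obtain ⟨-, V, _, _, _, π, ξ, η, U, hV, hπξ, hcoef, hU, hUi, hUs⟩ := hx
  obtain ⟨η₀, hη₀, hinv⟩ := HopfVN.HopfVonNeumannAlgebra.exists_invariant_mem_closure hV
    hπξ.norm_rep_le hπξ.map_conv hU hUi hUs η
  obtain ⟨y, hy, hΔ⟩ := HopfVN.HopfVonNeumannAlgebra.exists_comul_eq_mem_closure_rightOrbit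
    hπξ hcoef hη₀ hinv
  obtain ⟨c, rfl⟩ := hM y hΔ
  exact ⟨c, hy⟩
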